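/- **Theorem 8.1.** Let $1\le m\le n$ and let $V=M_{m,n}$ be the space of complex $m\times n$ matrices with the Frobenius form $q(U,T)=\mathrm{tr}(UT^{\mathsf T})=\sum_{i,j}u_{ij}t_{ij}$, and write $q(U)=q(U,U)$. For a nonempty irreducible algebraic set $X\subset V$ of codimension $c$, with ideal $I_X=\langle f_1,\dots,f_s\rangle\subset\mathbb C[x]$ and Jacobian matrix $J=(\partial f_i/\partial x_j)$, let $I_{X_{\mathrm{sing}}}=I_X+\langle c\times c\text{ minors of }J\rangle$, let $X_{\mathrm{sm}}=X\setminus X_{\mathrm{sing}}$ where $X_{\mathrm{sing}}$ is the zero locus of $I_{X_{\mathrm{sing}}}$, and let $$I_u=\Big(I_X+\Big\langle (c+1)\times(c+1)\text{ minors of }\begin{pmatrix}u-x\\ J\end{pmatrix}\Big\rangle\Big):(I_{X_{\mathrm{sing}}})^{\infty}\subset\mathbb C[x,u],$$ where $u$ is a vector of independent variables. We say that $\mathrm{EDpoly}_{X,u}(t^2)=F$ if $F\in\mathbb C[u,t]$ is a polynomial in $t^2$ and $F$ generates the elimination ideal $\big(I_u+(t^2-q(x-u))\big)\cap\mathbb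 C[u,t]$, where the sum is taken in $\mathbb C[x,u,t]$; this determines $F$ up to a nonzero constant factor. If $X$ is a cone, let the dual variety $X^\vee\subset V$ be the Zariski closure of the set of all $y\in V$ that are orthogonal with respect to $q$ to the tangent space $T_xX$ for some $x\in X_{\mathrm{sm}}$. Let $X=X_1\subset M_{m,n}$ be the cone of matrices of rank at most one, and let $U=(u_{ij})$ be the $m\times n$ matrix of variables. Then, up to nonzero constant factors, $$\mathrm{EDpoly}_{X^\vee,U}(t^2)=\det\!\left(UU^{\mathsf T}-t^2I_m\right),$$ $$\mathrm{EDpoly}_{X,U}(t^2)=(-1)^m\det\!\left(t^2I_m+UU^{\mathsf T}-\mathrm{tr}(UU^{\mathsf T})\,I_m\right).$$ -/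

import Mathlib

open Polynomial

noncomputable section

namespace EDPoly

/-- The ideal generated by the `k × k` minors of a matrix. The row and column selections are
arbitrary maps: non-injective ones contribute zero determinants, and reorderings only change signs.
The set of rows may be infinite. -/
def minorsIdeal {R ι κ : Type*} [CommRing R] (k : ℕ) (A : Matrix ι κ R) : Ideal R :=
  Ideal.span {d | ∃ (r : Fin k → ι) (c : Fin k → κ), d = (A.submatrix r c).det}

/-- The saturation `I : K^∞`, i.e. the union of the ideal quotients `I : K ^ k`. -/
def saturation {R : Type*} [CommRing R] (I K : Ideal R) : Ideal R where
  carrier := {p | ∃ k : ℕ, ∀ g ∈ K ^ k, p * g ∈ I}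
  zero_mem' := ⟨0, fun g _ => by simp⟩
  add_mem' := by
    rintro a b ⟨k, hk⟩ ⟨l, hl⟩
    refine ⟨k + l, fun g hg => ?_⟩
    rw [add_mul]
    exact I.add_mem (hk g (Ideal.pow_le_pow_right (Nat.le_add_right k l) hg))
      (hl g (Ideal.pow_le_pow_right (Nat.le_add_left l k) hg))
  smul_mem' := by
    rintro c a ⟨k, hk⟩
    refine ⟨k, fun g hg => ?_⟩
    rw [smul_eq_mul, mul_assoc]
    exact I.mul_mem_left c (hk g hg)

section Variety

variable {σ : Type*}

/-- The ideal `I_X ⊆ ℂ[x]` of an algebraic set `X ⊆ V = ℂ^σ`. -/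
def idealOf (X : Set (σ → ℂ)) : Ideal (MvPolynomial σ ℂ) :=
  MvPolynomial.vanishingIdeal ℂ X

/-- The codimension of a nonempty algebraic set, as the height of its ideal. -/
def codim (X : Set (σ → ℂ)) : ℕ := (idealOf X).height.toNat

/-- The Jacobian matrix of the elements of `I_X`. All elements of `I_X` are used as generators;
modulo `I_X`, the row of an element is a combination of the rows of any given generators, so that
the ideals built below from `I_X` and the minors do not depend on this choice. -/
def jacobian (X : Set (σ → ℂ)) : Matrix (idealOf X) σ (MvPolynomial σ ℂ) :=
  Matrix.of fun f j => MvPolynomial.pderiv j (f : MvPolynomial σ ℂ)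

/-- The ideal of the singular locus: `I_X` plus the `c × c` minors of the Jacobian,
`c = codim X`. -/
def singIdeal (X : Set (σ → ℂ)) : Ideal (MvPolynomial σ ℂ) :=
  idealOf X ⊔ minorsIdeal (codim X) (jacobian X)

/-- The smooth locus `X_sm = X \ X_sing`. -/
def smoothLocus (X : Set (σ → ℂ)) : Set (σ → ℂ) :=
  X \ MvPolynomial.zeroLocus ℂ (singIdeal X)

/-- `ℂ[x] → ℂ[x, u]`: the variable `x_i` is `Sum.inl i` and the variable `u_i` is `Sum.inr i`. -/
def inX : MvPolynomial σ ℂ →+* MvPolynomial (σ ⊕ σ) ℂ :=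
  (MvPolynomial.rename Sum.inl).toRingHom

/-- `ℂ[u] → ℂ[x, u]`. -/
def inU : MvPolynomial σ ℂ →+* MvPolynomial (σ ⊕ σ) ℂ :=
  (MvPolynomial.rename Sum.inr).toRingHom

/-- The Jacobian of `X` (in the variables `x`) with the row `u - x` added on top. -/
def augmentedJacobian (X : Set (σ → ℂ)) :
    Matrix (Option (idealOf X)) σ (MvPolynomial (σ ⊕ σ) ℂ) :=
  Matrix.of fun r j => match r with
    | none => MvPolynomial.X (Sum.inr j) - MvPolynomial.X (Sum.inl j)
    | some f => inX (jacobian X f j)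

/-- The critical ideal
`I_u = (I_X + ((c + 1) × (c + 1) minors of (u - x; J))) : (I_{X_sing})^∞` in `ℂ[x, u]`. -/
def criticalIdeal (X : Set (σ → ℂ)) : Ideal (MvPolynomial (σ ⊕ σ) ℂ) :=
  saturation ((idealOf X).map inX ⊔ minorsIdeal (codim X + 1) (augmentedJacobian X))
    ((singIdeal X).map inX)

variable [Fintype σ]

/-- The Zariski tangent space at `x`: the common kernel of the differentials at `x` of the
elements of `I_X`. -/
def tangentSpace (X : Set (σ → ℂ)) (x : σ → ℂ) : Set (σ → ℂ) :=
  {v | ∀ f ∈ idealOf X, ∑ i, MvPolynomial.eval x (MvPolynomial.pderiv i f) * v i = 0}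

/-- The dual variety `X^∨`: the Zariski closure of the set of all `y` that are orthogonal, for the
bilinear form `∑ i, y i * v i`, to the tangent space of `X` at some smooth point. -/
def dualVariety (X : Set (σ → ℂ)) : Set (σ → ℂ) :=
  MvPolynomial.zeroLocus ℂ (MvPolynomial.vanishingIdeal ℂ
    {y : σ → ℂ | ∃ x ∈ smoothLocus X, ∀ v ∈ tangentSpace X x, ∑ i, y i * v i = 0})

/-- `q(x - u) = ∑ i, (x_i - u_i)^2` in `ℂ[x, u]`. -/
def sqDist (σ : Type*) [Fintype σ] : MvPolynomial (σ ⊕ σ) ℂ :=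
  ∑ i : σ, (MvPolynomial.X (Sum.inl i) - MvPolynomial.X (Sum.inr i)) ^ 2

/-- The ideal `I_u + (t^2 - q(x - u))` of `ℂ[x, u][t]`. -/
def distanceIdeal (X : Set (σ → ℂ)) : Ideal (MvPolynomial (σ ⊕ σ) ℂ)[X] :=
  (criticalIdeal X).map (C : MvPolynomial (σ ⊕ σ) ℂ →+* (MvPolynomial (σ ⊕ σ) ℂ)[X]) ⊔
    Ideal.span {(Polynomial.X : (MvPolynomial (σ ⊕ σ) ℂ)[X]) ^ 2 - C (sqDist σ)}

/-- The elimination ideal of `I_u + (t^2 - q(x - u))` in `ℂ[u][t]` (the `x_i` are eliminated). -/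
def eliminationIdeal (X : Set (σ → ℂ)) : Ideal (MvPolynomial σ ℂ)[X] :=
  (distanceIdeal X).comap (Polynomial.mapRingHom inU)

/-- `F ∈ ℂ[u][t]` is the ED polynomial `EDpoly_{X,u}(t^2)` of `X`: it is a polynomial in `t^2` that
generates the elimination ideal. This determines `F` up to a nonzero constant factor, which is all
that the ED polynomial is defined up to. -/
def IsEDPoly (X : Set (σ → ℂ)) (F : (MvPolynomial σ ℂ)[X]) : Prop :=
  (∃ P : (MvPolynomial σ ℂ)[X], F = P.comp (Polynomial.X ^ 2)) ∧
    eliminationIdeal X = Ideal.span {F}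

end Variety

section Matrices

/-- The variety `X_r` of complex `m × n` matrices of rank at most `r`, in the space `M_{m,n}` with
coordinates indexed by the entries. On this space `∑ i, x i ^ 2` is the Frobenius form `tr(U Uᵀ)`. -/
def rankVariety (m n r : ℕ) : Set (Fin m × Fin n → ℂ) :=
  {x | (Matrix.of fun i j => x (i, j) : Matrix (Fin m) (Fin n) ℂ).rank ≤ r}

/-- The generic data matrix `U = (u_ij)`, with entries in `ℂ[u][t]`. -/
def dataMatrix (m n : ℕ) :
    Matrix (Fin m) (Fin n) (MvPolynomial (Fin m × Fin n) ℂ)[X] :=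
  Matrix.of fun i j => C (MvPolynomial.X (i, j))

end Matrices

end EDPoly

end

/-!
Write `q` for the Frobenius form and let `X_r` be the variety of `m × n` matrices of rank at most
`r`. A matrix `y` is normal to `X_r` at a matrix `x` of rank `r` exactly if `xᵀ y = 0` and
`x yᵀ = 0`, while all gradients of equations of `X_r` vanish at matrices of smaller rank. In
particular a matrix is normal to `X_1` at a smooth point if and only if its rank is less than `m`,
so `X_1^∨ = X_{m-1}` (`dualVariety_rankVariety_one`).

If `u = z + w`, where `z` has rank one and `z`, `w` are normal to each other, then `z = αβᵀ`, `α` is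
an eigenvector of `u uᵀ` with eigenvalue `q(z)`, and `q(w) = tr(u uᵀ) - q(z)`. On `X_{m-1}` the
critical points for the data `u` are the matrices `w` arising in this way, at squared distance
`q(z)`; on `X_1` they are the matrices `z`, at squared distance `q(w)`. So the squared distances are
the roots of the characteristic polynomials of `U Uᵀ` and of `tr(U Uᵀ) - U Uᵀ`, which up to sign are
the two determinants in question.

To pass from points to the ideals that define ED polynomials, three facts are needed.

* The codimension of `X_r` is `(m - r)(n - r)` (`codim_rankVariety`). The lower bound comes from a
  chain of primes, the kernels of parametrizations `(A, B, E) ↦ A B + E` with fewer and fewer entries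
  allowed in `E`; the upper bound is Krull's height theorem, as `X_r` is cut out by that many minors
  where the top left `r × r` minor does not vanish.
* A polynomial vanishing on all pairs `(x, x + y)` with `x ∈ X` and `y` normal to `X` at `x` lies in
  the critical ideal (`mem_criticalIdeal`); this is where the critical ideal is seen to be radical.
  Conversely, an element of the critical ideal of `X_r` vanishes at such a pair if `x` has rank
  exactly `r` (`eval_eq_zero_of_mem_criticalIdeal`).
* If `q(x - u)` is a root of `Q ∈ ℂ[u][s]` modulo the critical ideal, then `Q` is divisible by the
  characteristic polynomial `χ` (`dvd_of_generic_roots`). By the spectral theorem, a generic real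
  matrix `u` has `m` critical points with distinct squared distances. There the remainder of `Q` by
  `χ` has more roots than its degree, and real matrices are Zariski dense.

The polynomials in `t` reduce to polynomials in `s = t²` because `R[t] / (t² - q)` is free over `R`
on `1` and `t` (`isEDPoly_of_forall_dvd`).
-/

noncomputable section

namespace EDPoly

/-! ### Rank factorizations, kernels and minors -/

section LinearAlgebra

variable {K : Type*} [Field K] {ι κ : Type*} [Fintype ι]

/-- A subspace `S` of `ι → K` of dimension `d` is the column space of a matrix `N` with `d` columns
and a left inverse `N'`; then `N * N'` is a projection onto `S`. -/
theorem exists_basis_matrix [DecidableEq ι] (S : Submodule K (ι → K)) {d : ℕ}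
    (h : Module.finrank K S = d) :
    ∃ (N : Matrix ι (Fin d) K) (N' : Matrix (Fin d) ι K), N' * N = 1 ∧
      (∀ z, N.mulVec z ∈ S) ∧ ∀ v ∈ S, N.mulVec (N'.mulVec v) = v := by
  let b := (Module.finBasisOfFinrankEq K S h).equivFun
  let f : (Fin d → K) →ₗ[K] (ι → K) := S.subtype ∘ₗ b.symm.toLinearMap
  have hf : LinearMap.ker f = ⊥ := by
    rw [LinearMap.ker_eq_bot]
    exact S.injective_subtype.comp b.symm.injective
  obtain ⟨g, hg⟩ := f.exists_leftInverse_of_injective hf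
  have hN : ∀ z, (LinearMap.toMatrix' f).mulVec z = f z := fun z => LinearMap.toMatrix'_mulVec f z
  have hN' : ∀ z, (LinearMap.toMatrix' g).mulVec z = g z := fun z => LinearMap.toMatrix'_mulVec g z
  refine ⟨LinearMap.toMatrix' f, LinearMap.toMatrix' g, ?_, fun z => ?_, fun v hv => ?_⟩
  · rw [← LinearMap.toMatrix'_comp, hg, LinearMap.toMatrix'_id]
  · rw [hN]; exact (b.symm z).2
  · have : f (b ⟨v, hv⟩) = v := by simp [f]
    rw [hN, hN', ← this]
    congr 1
    exact LinearMap.congr_fun hg _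

theorem one_submatrix_castLE_mul {k r : ℕ} (h : k ≤ r) :
    (1 : Matrix (Fin r) (Fin r) K).submatrix (Fin.castLE h) id *
      (1 : Matrix (Fin r) (Fin r) K).submatrix id (Fin.castLE h) = 1 := by
  rw [← Matrix.submatrix_mul _ _ _ id _ Function.bijective_id, mul_one]
  exact Matrix.submatrix_one _ (Fin.castLE_injective h)

theorem exists_mul_of_rank_le [DecidableEq ι] [Fintype κ] [DecidableEq κ]
    {x : Matrix ι κ K} {r : ℕ} (h : x.rank ≤ r) :
    ∃ (A : Matrix ι (Fin r) K) (B : Matrix (Fin r) κ K), x = A * B := by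
  obtain ⟨N, N', -, -, hN⟩ := exists_basis_matrix (LinearMap.range x.mulVecLin) (d := x.rank) rfl
  refine ⟨N * (1 : Matrix (Fin r) (Fin r) K).submatrix (Fin.castLE h) id,
    (1 : Matrix (Fin r) (Fin r) K).submatrix id (Fin.castLE h) * (N' * x), ?_⟩
  rw [Matrix.mul_assoc, ← Matrix.mul_assoc _ _ (N' * x), one_submatrix_castLE_mul, Matrix.one_mul]
  refine Matrix.ext_of_mulVec_single fun j => ?_
  rw [← Matrix.mulVec_mulVec, ← Matrix.mulVec_mulVec]
  exact (hN _ ⟨_, rfl⟩).symm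

theorem exists_mul_mul_eq_one [DecidableEq ι] [Fintype κ] [DecidableEq κ]
    {x : Matrix ι κ K} {k : ℕ} (h : k ≤ x.rank) :
    ∃ (P : Matrix (Fin k) ι K) (Q : Matrix κ (Fin k) K), P * x * Q = 1 := by
  obtain ⟨N, N', h1, h2, -⟩ := exists_basis_matrix (LinearMap.range x.mulVecLin) (d := x.rank) rfl
  choose q hq using fun i => h2 (Pi.single i 1)
  have hQ : x * Matrix.of (fun j i => q i j) = N := by
    refine Matrix.ext_of_mulVec_single fun i => ?_
    rw [← hq i, ← Matrix.mulVec_mulVec, Matrix.mulVec_single_one]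
    rfl
  refine ⟨(1 : Matrix (Fin x.rank) (Fin x.rank) K).submatrix (Fin.castLE h) id * N',
    Matrix.of (fun j i => q i j) *
      (1 : Matrix (Fin x.rank) (Fin x.rank) K).submatrix id (Fin.castLE h), ?_⟩
  calc _ = (1 : Matrix (Fin x.rank) (Fin x.rank) K).submatrix (Fin.castLE h) id *
        (N' * (x * Matrix.of (fun j i => q i j))) *
          (1 : Matrix (Fin x.rank) (Fin x.rank) K).submatrix id (Fin.castLE h) := by
        simp only [Matrix.mul_assoc]
    _ = _ := by
        rw [hQ, h1, Matrix.mul_one, one_submatrix_castLE_mul]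

theorem exists_kernel_matrix [DecidableEq ι] (x : Matrix κ ι K) {d : ℕ}
    (h : x.rank + d = Fintype.card ι) :
    ∃ (N : Matrix ι (Fin d) K) (N' : Matrix (Fin d) ι K), N' * N = 1 ∧ x * N = 0 ∧
      ∀ {τ : Type} [Fintype τ] [DecidableEq τ] (y : Matrix ι τ K), x * y = 0 →
        N * (N' * y) = y := by
  have hd : Module.finrank K (LinearMap.ker x.mulVecLin) = d := by
    have := LinearMap.finrank_range_add_finrank_ker x.mulVecLin
    rw [Module.finrank_fintype_fun_eq_card, ← h] at this
    exact Nat.add_left_cancel this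
  obtain ⟨N, N', h1, h2, h3⟩ := exists_basis_matrix _ hd
  refine ⟨N, N', h1, ?_, fun y hy => ?_⟩
  · refine Matrix.ext_of_mulVec_single fun j => ?_
    rw [← Matrix.mulVec_mulVec, Matrix.zero_mulVec]
    exact h2 _
  · refine Matrix.ext_of_mulVec_single fun j => ?_
    rw [← Matrix.mulVec_mulVec, ← Matrix.mulVec_mulVec]
    refine h3 _ ?_
    rw [LinearMap.mem_ker, Matrix.mulVecLin_apply, Matrix.mulVec_mulVec, hy, Matrix.zero_mulVec]

theorem exists_det_submatrix_ne_zero {c : ℕ} {A : Matrix (Fin c) ι K}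
    {B : Matrix ι (Fin c) K} (h : A * B = 1) :
    ∃ e : Fin c → ι, (A.submatrix id e).det ≠ 0 := by
  have hs : Submodule.span K (Set.range A.col) = ⊤ := by
    rw [← Matrix.range_mulVecLin, LinearMap.range_eq_top]
    intro v
    exact ⟨B.mulVec v, by simp [Matrix.mulVec_mulVec, h]⟩
  obtain ⟨f, hf, -, hli⟩ := Submodule.exists_fun_fin_finrank_span_eq K (Set.range A.col)
  have hc : Module.finrank K (Submodule.span K (Set.range A.col)) = c := by
    rw [hs, finrank_top, Module.finrank_fin_fun]
  choose e he using hf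
  refine ⟨fun i => e (Fin.cast hc.symm i), ?_⟩
  have : LinearIndependent K (A.submatrix id fun i => e (Fin.cast hc.symm i)).col := by
    have h2 := hli.comp (Fin.cast hc.symm) (Fin.cast_injective _)
    have h3 : (A.submatrix id fun i => e (Fin.cast hc.symm i)).col = f ∘ Fin.cast hc.symm :=
      funext fun i => he _
    rwa [h3]
  rw [Matrix.linearIndependent_cols_iff_isUnit, Matrix.isUnit_iff_isUnit_det] at this
  exact this.ne_zero

theorem det_mul_eq_zero_of_lt {c d : ℕ} (h : c < d) (A : Matrix (Fin d) (Fin c) K)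
    (B : Matrix (Fin c) (Fin d) K) : (A * B).det = 0 := by
  by_contra h0
  have h1 := Matrix.rank_of_det_ne_zero h0
  have h2 := (Matrix.rank_mul_le_left A B).trans (Matrix.rank_le_width A)
  rw [Fintype.card_fin] at h1
  omega

end LinearAlgebra

/-! ### Bordered minors -/

section Border

variable {R : Type*} [CommRing R] {m n r : ℕ}

/-- For a matrix `Y` with top left `r × r` block `Y₁₁`, the matrix
`det Y₁₁ • Y - Y_{*1} * adj Y₁₁ * Y_{1*}`, whose `(i, j)` entry is the `(r + 1) × (r + 1)` minor of
`Y` bordering `Y₁₁` by the row `i` and the column `j`. -/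
def borderedMinors (hm : r ≤ m) (hn : r ≤ n) (Y : Matrix (Fin m) (Fin n) R) :
    Matrix (Fin m) (Fin n) R :=
  (Y.submatrix (Fin.castLE hm) (Fin.castLE hn)).det • Y -
    Y.submatrix id (Fin.castLE hn) * (Y.submatrix (Fin.castLE hm) (Fin.castLE hn)).adjugate *
      Y.submatrix (Fin.castLE hm) id

theorem borderedMinors_map {S : Type*} [CommRing S] (φ : R →+* S) (hm : r ≤ m) (hn : r ≤ n)
    (Y : Matrix (Fin m) (Fin n) R) :
    (borderedMinors hm hn Y).map φ = borderedMinors hm hn (Y.map φ) := by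
  have h1 : (Y.map φ).submatrix (Fin.castLE hm) (Fin.castLE hn) =
    φ.mapMatrix (Y.submatrix (Fin.castLE hm) (Fin.castLE hn)) := rfl
  unfold borderedMinors
  rw [h1, ← RingHom.map_det, ← RingHom.map_adjugate]
  ext i j
  simp [Matrix.mul_apply]

/-- Pivoting on an `r × r` block reproduces a matrix `A * B` of rank at most `r`. -/
theorem mul_adjugate_mul_mul {ι κ : Type*} (A : Matrix ι (Fin r) R) (B : Matrix (Fin r) κ R)
    (A₁ B₁ : Matrix (Fin r) (Fin r) R) :
    A * B₁ * (A₁ * B₁).adjugate * (A₁ * B) = (A₁ * B₁).det • (A * B) := by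
  rw [Matrix.adjugate_mul_distrib, Matrix.det_mul]
  calc _ = A * (B₁ * B₁.adjugate) * (A₁.adjugate * A₁) * B := by simp only [Matrix.mul_assoc]
    _ = _ := by
        rw [Matrix.mul_adjugate, Matrix.adjugate_mul]
        simp [smul_smul, Matrix.mul_smul, Matrix.smul_mul]

theorem borderedMinors_mul (hm : r ≤ m) (hn : r ≤ n) (A : Matrix (Fin m) (Fin r) R)
    (B : Matrix (Fin r) (Fin n) R) : borderedMinors hm hn (A * B) = 0 := by
  have h1 : (A * B).submatrix (Fin.castLE hm) (Fin.castLE hn) =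
      A.submatrix (Fin.castLE hm) id * B.submatrix id (Fin.castLE hn) :=
    Matrix.submatrix_mul _ _ _ id _ Function.bijective_id
  have h2 : (A * B).submatrix id (Fin.castLE hn) = A * B.submatrix id (Fin.castLE hn) :=
    Matrix.submatrix_mul _ _ _ id _ Function.bijective_id
  have h3 : (A * B).submatrix (Fin.castLE hm) id = A.submatrix (Fin.castLE hm) id * B :=
    Matrix.submatrix_mul _ _ _ id _ Function.bijective_id
  unfold borderedMinors
  rw [h1, h2, h3, mul_adjugate_mul_mul, sub_self]

/-- A perturbation `E` outside the first `r` rows and columns is seen by the bordered minors only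
through the pivot times `E`. -/
theorem borderedMinors_mul_add (hm : r ≤ m) (hn : r ≤ n) (A : Matrix (Fin m) (Fin r) R)
    (B : Matrix (Fin r) (Fin n) R) (E : Matrix (Fin m) (Fin n) R)
    (h₁ : E.submatrix (Fin.castLE hm) id = 0) (h₂ : E.submatrix id (Fin.castLE hn) = 0) :
    borderedMinors hm hn (A * B + E) =
      ((A * B).submatrix (Fin.castLE hm) (Fin.castLE hn)).det • E := by
  have h3 : E.submatrix (Fin.castLE hm) (Fin.castLE hn) = 0 := by
    ext i j
    exact congrFun (congrFun h₁ i) (Fin.castLE hn j)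
  have h := borderedMinors_mul hm hn A B
  unfold borderedMinors at h ⊢
  simp only [Matrix.submatrix_add, Pi.add_apply, h₁, h₂, h3, add_zero]
  rw [smul_add, add_sub_right_comm, h, zero_add]

theorem borderedMinors_apply_eq_zero (hm : r ≤ m) (hn : r ≤ n) (Y : Matrix (Fin m) (Fin n) R)
    {i : Fin m} {j : Fin n} (h : (i : ℕ) < r ∨ (j : ℕ) < r) : borderedMinors hm hn Y i j = 0 := by
  have e : ∀ {a b : ℕ} (f : Fin a → Fin m) (g : Fin b → Fin n),
      (Y.submatrix id (Fin.castLE hn) * (Y.submatrix (Fin.castLE hm) (Fin.castLE hn)).adjugate *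
        Y.submatrix (Fin.castLE hm) id).submatrix f g = Y.submatrix f (Fin.castLE hn) *
        (Y.submatrix (Fin.castLE hm) (Fin.castLE hn)).adjugate * Y.submatrix (Fin.castLE hm) g :=
    fun f g => rfl
  rw [borderedMinors, Matrix.sub_apply, sub_eq_zero]
  rcases h with h | h
  · have e1 := e (Fin.castLE hm) id
    rw [Matrix.mul_adjugate, Matrix.smul_mul, Matrix.one_mul] at e1
    exact (congrFun (congrFun e1 ⟨i, h⟩) j).symm
  · have e1 := (e id (Fin.castLE hn)).trans (Matrix.mul_assoc _ _ _)
    rw [Matrix.adjugate_mul, Matrix.mul_smul, Matrix.mul_one] at e1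
    exact (congrFun (congrFun e1 i) ⟨j, h⟩).symm

end Border

/-! ### Solving for variables modulo an ideal -/

section Elimination

theorem det_mem_subalgebra {R A ι : Type*} [CommRing R] [CommRing A] [Algebra R A] [Fintype ι]
    [DecidableEq ι] {S : Subalgebra R A} {M : Matrix ι ι A} (h : ∀ i j, M i j ∈ S) : M.det ∈ S := by
  rw [Matrix.det_apply]
  exact S.sum_mem fun σ _ => by
    rw [Units.smul_def, zsmul_eq_mul]
    exact S.mul_mem (intCast_mem _ _) (S.prod_mem fun i _ => h _ _)

/-- If each variable becomes, modulo `I` and after multiplication by `f ∈ S`, an element of the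
subalgebra `S`, then so does each polynomial after multiplication by a power of `f`. -/
theorem exists_pow_mul_sub_mem {σ R : Type*} [CommRing R] {I : Ideal (MvPolynomial σ R)}
    {S : Subalgebra R (MvPolynomial σ R)} {f : MvPolynomial σ R} (hf : f ∈ S)
    (h : ∀ i, ∃ s ∈ S, f * MvPolynomial.X i - s ∈ I) (g : MvPolynomial σ R) :
    ∃ k : ℕ, ∃ s ∈ S, f ^ k * g - s ∈ I := by
  induction g using MvPolynomial.induction_on with
  | C a => exact ⟨0, _, S.algebraMap_mem a, by simp [MvPolynomial.algebraMap_eq]⟩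
  | add p q hp hq =>
    obtain ⟨k, s, hs, hks⟩ := hp
    obtain ⟨l, t, ht, hlt⟩ := hq
    refine ⟨k + l, f ^ l * s + f ^ k * t,
      S.add_mem (S.mul_mem (S.pow_mem hf _) hs) (S.mul_mem (S.pow_mem hf _) ht), ?_⟩
    have := I.add_mem (I.mul_mem_left (f ^ l) hks) (I.mul_mem_left (f ^ k) hlt)
    convert this using 1
    ring
  | mul_X p i hp =>
    obtain ⟨k, s, hs, hks⟩ := hp
    obtain ⟨t, ht, hlt⟩ := h i
    refine ⟨k + 1, s * t, S.mul_mem hs ht, ?_⟩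
    have := I.add_mem (I.mul_mem_left (f * MvPolynomial.X i) hks) (I.mul_mem_left s hlt)
    convert this using 1
    ring

theorem aeval_eq_of_mem_supported {σ R A : Type*} [CommRing R] [CommRing A] [Algebra R A]
    {T : Set σ} {p : MvPolynomial σ R} (hp : p ∈ MvPolynomial.supported R T) {x y : σ → A}
    (h : ∀ i ∈ T, x i = y i) : MvPolynomial.aeval x p = MvPolynomial.aeval y p := by
  rw [MvPolynomial.mem_supported] at hp
  refine MvPolynomial.hom_congr_vars (f₁ := (MvPolynomial.aeval x).toRingHom)
    (f₂ := (MvPolynomial.aeval y).toRingHom) ?_ ?_ rfl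
  · ext a; simp
  · intro i hi _
    simpa using h i (hp hi)

end Elimination

/-! ### The codimension of the rank varieties -/

section Codim

variable {m n r : ℕ}

/-- A point of `M_{m,n}` as a matrix. -/
def toMat (x : Fin m × Fin n → ℂ) : Matrix (Fin m) (Fin n) ℂ := Matrix.of fun i j => x (i, j)

/-- A matrix as a point of `M_{m,n}`. -/
def ofMat (A : Matrix (Fin m) (Fin n) ℂ) : Fin m × Fin n → ℂ := fun p => A p.1 p.2

@[simp] theorem toMat_ofMat (A : Matrix (Fin m) (Fin n) ℂ) : toMat (ofMat A) = A := rfl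

@[simp] theorem ofMat_toMat (x : Fin m × Fin n → ℂ) : ofMat (toMat x) = x := rfl

theorem mem_rankVariety {x : Fin m × Fin n → ℂ} : x ∈ rankVariety m n r ↔ (toMat x).rank ≤ r :=
  Iff.rfl

theorem ofMat_mul_mem (A : Matrix (Fin m) (Fin r) ℂ) (B : Matrix (Fin r) (Fin n) ℂ) :
    ofMat (A * B) ∈ rankVariety m n r :=
  (Matrix.rank_mul_le_left A B).trans (Matrix.rank_le_width A)

theorem exists_ofMat_mul {x : Fin m × Fin n → ℂ} (hx : x ∈ rankVariety m n r) :
    ∃ (A : Matrix (Fin m) (Fin r) ℂ) (B : Matrix (Fin r) (Fin n) ℂ), x = ofMat (A * B) := by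
  obtain ⟨A, B, h⟩ := exists_mul_of_rank_le (mem_rankVariety.1 hx)
  exact ⟨A, B, by rw [← h, ofMat_toMat]⟩

/-- The positions outside the first `r` rows and the first `r` columns. -/
def corner (m n r : ℕ) : Finset (Fin m × Fin n) :=
  Finset.univ.filter (fun i : Fin m => r ≤ i) ×ˢ Finset.univ.filter (fun j : Fin n => r ≤ j)

theorem mem_corner {p : Fin m × Fin n} : p ∈ corner m n r ↔ r ≤ p.1 ∧ r ≤ p.2 := by
  simp [corner]

theorem card_corner (m n r : ℕ) : (corner m n r).card = (m - r) * (n - r) := by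
  have h : ∀ k : ℕ, (Finset.univ.filter (fun i : Fin k => r ≤ i)).card = k - r := by
    intro k
    rw [← Finset.card_map Fin.valEmbedding, ← Nat.card_Ico]
    congr 1
    ext i
    simp only [Finset.mem_map, Finset.mem_filter, Finset.mem_univ, true_and,
      Fin.valEmbedding_apply, Finset.mem_Ico]
    exact ⟨fun ⟨a, h, e⟩ => e ▸ ⟨h, a.isLt⟩, fun h => ⟨⟨i, h.2⟩, h.1, rfl⟩⟩
  rw [corner, Finset.card_product, h, h]

/-- The coordinate ring of the space of triples `(A, B, E)`, where `A` is `m × r`, `B` is `r × n`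
and `E` is `m × n`. -/
abbrev ParamRing (m n r : ℕ) :=
  MvPolynomial ((Fin m × Fin r) ⊕ (Fin r × Fin n) ⊕ (Fin m × Fin n)) ℂ

/-- The generic `m × r` factor. -/
def paramA (m n r : ℕ) : Matrix (Fin m) (Fin r) (ParamRing m n r) :=
  Matrix.of fun i k => MvPolynomial.X (Sum.inl (i, k))

/-- The generic `r × n` factor. -/
def paramB (m n r : ℕ) : Matrix (Fin r) (Fin n) (ParamRing m n r) :=
  Matrix.of fun k j => MvPolynomial.X (Sum.inr (Sum.inl (k, j)))

/-- The generic matrix supported in the corner positions outside `S`. -/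
def paramE (m n r : ℕ) (S : Finset (Fin m × Fin n)) : Matrix (Fin m) (Fin n) (ParamRing m n r) :=
  Matrix.of fun i j =>
    if (i, j) ∈ corner m n r \ S then MvPolynomial.X (Sum.inr (Sum.inr (i, j))) else 0

/-- The comorphism of `(A, B, E) ↦ A * B + E`, with `E` supported in the corner outside `S`. -/
def paramHom (m n r : ℕ) (S : Finset (Fin m × Fin n)) :
    MvPolynomial (Fin m × Fin n) ℂ →ₐ[ℂ] ParamRing m n r :=
  MvPolynomial.aeval fun p => (paramA m n r * paramB m n r + paramE m n r S) p.1 p.2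

/-- The prime ideal of the closure of the set of all `A * B + E` with `E` supported in the corner
outside `S`. -/
def paramIdeal (m n r : ℕ) (S : Finset (Fin m × Fin n)) : Ideal (MvPolynomial (Fin m × Fin n) ℂ) :=
  RingHom.ker (paramHom m n r S)

instance (S : Finset (Fin m × Fin n)) : (paramIdeal m n r S).IsPrime := RingHom.ker_isPrime _

theorem idealOf_rankVariety : idealOf (rankVariety m n r) = paramIdeal m n r (corner m n r) := by
  have key : ∀ (v : (Fin m × Fin r) ⊕ (Fin r × Fin n) ⊕ (Fin m × Fin n) → ℂ)
      (g : MvPolynomial (Fin m × Fin n) ℂ),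
      MvPolynomial.eval v (paramHom m n r (corner m n r) g) =
        MvPolynomial.aeval (ofMat ((Matrix.of fun i k => v (Sum.inl (i, k))) *
          (Matrix.of fun k j => v (Sum.inr (Sum.inl (k, j)))))) g := by
    intro v g
    rw [← MvPolynomial.coe_aeval_eq_eval, RingHom.coe_coe, ← AlgHom.comp_apply]
    congr 1
    ext1 p
    simp [paramHom, paramE, Matrix.mul_apply, paramA, paramB, ofMat]
  ext g
  rw [paramIdeal, RingHom.mem_ker]
  constructor
  · intro hg
    refine MvPolynomial.funext fun v => ?_
    rw [key, map_zero]
    exact hg _ (ofMat_mul_mem _ _)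
  · intro hg x hx
    obtain ⟨A, B, rfl⟩ := exists_ofMat_mul hx
    have := key (Sum.elim (fun p => A p.1 p.2) (Sum.elim (fun p => B p.1 p.2) 0)) g
    rw [hg, map_zero] at this
    exact this.symm

instance : (idealOf (rankVariety m n r)).IsPrime := by
  rw [idealOf_rankVariety]
  infer_instance

theorem map_mvPolynomialX_paramHom (S : Finset (Fin m × Fin n)) :
    (Matrix.mvPolynomialX (Fin m) (Fin n) ℂ).map (paramHom m n r S) =
      paramA m n r * paramB m n r + paramE m n r S := by
  ext1 i j
  simp [paramHom]

theorem paramHom_borderedMinors (hm : r ≤ m) (hn : r ≤ n) (S : Finset (Fin m × Fin n))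
    (i : Fin m) (j : Fin n) :
    paramHom m n r S (borderedMinors hm hn (Matrix.mvPolynomialX (Fin m) (Fin n) ℂ) i j) =
      ((paramA m n r * paramB m n r).submatrix (Fin.castLE hm) (Fin.castLE hn)).det *
        paramE m n r S i j := by
  have h := borderedMinors_map (paramHom m n r S).toRingHom hm hn
    (Matrix.mvPolynomialX (Fin m) (Fin n) ℂ)
  have h' := congrFun (congrFun h i) j
  have e : (Matrix.mvPolynomialX (Fin m) (Fin n) ℂ).map (paramHom m n r S).toRingHom = _ :=
    map_mvPolynomialX_paramHom S
  rw [e, borderedMinors_mul_add] at h'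
  · exact h'
  · refine Matrix.ext fun i j => if_neg ?_
    rw [Finset.mem_sdiff, mem_corner]
    exact fun h => (i.isLt.trans_le h.1.1).false
  · refine Matrix.ext fun i j => if_neg ?_
    rw [Finset.mem_sdiff, mem_corner]
    exact fun h => (j.isLt.trans_le h.1.2).false

theorem paramPivot_ne_zero (hm : r ≤ m) (hn : r ≤ n) :
    ((paramA m n r * paramB m n r).submatrix (Fin.castLE hm) (Fin.castLE hn)).det ≠ 0 := by
  intro h
  let v : (Fin m × Fin r) ⊕ (Fin r × Fin n) ⊕ (Fin m × Fin n) → ℂ :=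
    Sum.elim (fun p => if (p.1 : ℕ) = p.2 then 1 else 0)
      (Sum.elim (fun p => if (p.1 : ℕ) = p.2 then 1 else 0) 0)
  have h1 := congrArg (MvPolynomial.eval v) h
  rw [RingHom.map_det, map_zero] at h1
  have h2 : (MvPolynomial.eval v).mapMatrix ((paramA m n r * paramB m n r).submatrix
      (Fin.castLE hm) (Fin.castLE hn)) = 1 := by
    ext i j
    simp only [RingHom.mapMatrix_apply, Matrix.map_apply, Matrix.submatrix_apply, Matrix.mul_apply,
      paramA, paramB, Matrix.of_apply, map_sum, map_mul, MvPolynomial.eval_X, Sum.elim_inl,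
      Sum.elim_inr, v, Fin.val_castLE, ← Fin.ext_iff, Matrix.one_apply]
    simp
  rw [h2] at h1
  simp at h1

/-- The inclusion is strict since the minor bordering the pivot by the position `p` is
`det (A B)₁₁ * E_p` in the parametrization. -/
theorem paramIdeal_lt (hm : r ≤ m) (hn : r ≤ n) {S : Finset (Fin m × Fin n)} {p : Fin m × Fin n}
    (hp : p ∈ corner m n r) (hpS : p ∉ S) : paramIdeal m n r S < paramIdeal m n r (insert p S) := by
  refine lt_of_le_of_ne ?_ fun h => ?_
  · let ψ : ParamRing m n r →ₐ[ℂ] ParamRing m n r := MvPolynomial.aeval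
      (Sum.elim (fun q => MvPolynomial.X (Sum.inl q)) (Sum.elim
        (fun q => MvPolynomial.X (Sum.inr (Sum.inl q)))
        (fun q => if q = p then 0 else MvPolynomial.X (Sum.inr (Sum.inr q)))))
    have hψ : ψ.comp (paramHom m n r S) = paramHom m n r (insert p S) := by
      ext1 q
      simp only [paramHom, AlgHom.comp_apply, MvPolynomial.aeval_X, Matrix.add_apply, map_add]
      congr 1
      · simp [Matrix.mul_apply, paramA, paramB, ψ]
      · rcases eq_or_ne q p with rfl | hq
        · simp [paramE, ψ, hp, hpS]
        · by_cases hq2 : q ∈ S <;> by_cases hq3 : q ∈ corner m n r <;>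
            simp [paramE, ψ, hq, hq2, hq3]
    intro g hg
    rw [paramIdeal, RingHom.mem_ker] at hg ⊢
    rw [← hψ, AlgHom.comp_apply, hg, map_zero]
  · have h1 : borderedMinors hm hn (Matrix.mvPolynomialX (Fin m) (Fin n) ℂ) p.1 p.2 ∈
        paramIdeal m n r (insert p S) := by
      rw [paramIdeal, RingHom.mem_ker, paramHom_borderedMinors]
      simp [paramE]
    rw [← h, paramIdeal, RingHom.mem_ker, paramHom_borderedMinors] at h1
    refine mul_ne_zero (paramPivot_ne_zero hm hn) ?_ h1
    simp [paramE, hp, hpS, MvPolynomial.X_ne_zero]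

/-- Removing the positions of `S` from `E` one at a time gives a chain of primes below
`paramIdeal m n r S`. -/
theorem card_le_height_paramIdeal (hm : r ≤ m) (hn : r ≤ n) (S : Finset (Fin m × Fin n))
    (hS : S ⊆ corner m n r) : (S.card : ℕ∞) ≤ (paramIdeal m n r S).height := by
  induction S using Finset.induction_on with
  | empty => simp
  | insert p S hp ih =>
    rw [Finset.card_insert_of_notMem hp, Nat.cast_add, Nat.cast_one]
    refine (add_le_add_left (ih fun q hq => hS (Finset.mem_insert_of_mem hq)) 1).trans ?_
    exact Ideal.height_add_one_le_of_lt_of_isPrime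
      (paramIdeal_lt hm hn (hS (Finset.mem_insert_self _ _)) hp)

/-- Near a matrix whose top left `r × r` block is invertible, `X_r` is cut out by the minors
bordering that block. -/
theorem height_idealOf_rankVariety_le (hm : r ≤ m) (hn : r ≤ n) :
    (idealOf (rankVariety m n r)).height ≤ ((m - r) * (n - r) : ℕ) := by
  classical
  set p := idealOf (rankVariety m n r) with hp
  set G := Matrix.mvPolynomialX (Fin m) (Fin n) ℂ with hG
  set f := (G.submatrix (Fin.castLE hm) (Fin.castLE hn)).det with hf
  let s : Finset (MvPolynomial (Fin m × Fin n) ℂ) :=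
    (corner m n r).image fun q => borderedMinors hm hn G q.1 q.2
  have hsp : Ideal.span (s : Set (MvPolynomial (Fin m × Fin n) ℂ)) ≤ p := by
    rw [Ideal.span_le]
    intro g hg
    obtain ⟨q, -, rfl⟩ := Finset.mem_image.1 hg
    rw [SetLike.mem_coe, hp, idealOf_rankVariety, paramIdeal, RingHom.mem_ker,
      paramHom_borderedMinors]
    simp [paramE]
  have hfp : f ∉ p := by
    rw [hp, idealOf_rankVariety, paramIdeal, RingHom.mem_ker]
    have e : (paramHom m n r (corner m n r)) f = ((G.map (paramHom m n r (corner m n r))).submatrix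
        (Fin.castLE hm) (Fin.castLE hn)).det := AlgHom.map_det _ _
    have e0 : paramE m n r (corner m n r) = 0 := by
      ext1 i j
      simp [paramE]
    rw [e, map_mvPolynomialX_paramHom, e0, add_zero]
    exact paramPivot_ne_zero hm hn
  suffices hmin : p ∈ (Ideal.span (s : Set (MvPolynomial (Fin m × Fin n) ℂ))).minimalPrimes by
    refine (Ideal.height_le_card_of_mem_minimalPrimes_span_finset hmin).trans ?_
    rw [← card_corner]
    exact_mod_cast Finset.card_image_le
  refine ⟨⟨inferInstance, hsp⟩, fun q ⟨hq, hsq⟩ hqp g hg => ?_⟩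
  have hXS : ∀ (i : Fin m) (j : Fin n), ((i : ℕ) < r ∨ (j : ℕ) < r) →
      G i j ∈ MvPolynomial.supported ℂ {q : Fin m × Fin n | (q.1 : ℕ) < r ∨ (q.2 : ℕ) < r} :=
    fun i j h => MvPolynomial.X_mem_supported.2 h
  set S := MvPolynomial.supported ℂ {q : Fin m × Fin n | (q.1 : ℕ) < r ∨ (q.2 : ℕ) < r} with hS
  have hfS : f ∈ S := det_mem_subalgebra fun i j => hXS _ _ (Or.inl i.isLt)
  obtain ⟨k, t, htS, ht⟩ := exists_pow_mul_sub_mem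
    (I := Ideal.span (s : Set (MvPolynomial (Fin m × Fin n) ℂ))) hfS (fun a => by
      by_cases ha : (a.1 : ℕ) < r ∨ (a.2 : ℕ) < r
      · exact ⟨f * G a.1 a.2, S.mul_mem hfS (hXS _ _ ha), by simp [hG]⟩
      · refine ⟨f * G a.1 a.2 - borderedMinors hm hn G a.1 a.2, ?_, ?_⟩
        · rw [borderedMinors, Matrix.sub_apply, Matrix.smul_apply, smul_eq_mul, sub_sub_cancel]
          rw [Matrix.mul_apply]
          refine S.sum_mem fun l _ => S.mul_mem ?_ (hXS _ _ (Or.inl l.isLt))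
          rw [Matrix.mul_apply]
          refine S.sum_mem fun l' _ => S.mul_mem (hXS _ _ (Or.inr l'.isLt)) ?_
          rw [Matrix.adjugate_apply]
          refine det_mem_subalgebra fun i j => ?_
          rw [Matrix.updateRow_apply]
          split_ifs
          · rw [Pi.single_apply]
            split_ifs
            exacts [S.one_mem, S.zero_mem]
          · exact hXS _ _ (Or.inl i.isLt)
        · have e : f * MvPolynomial.X a - (f * G a.1 a.2 - borderedMinors hm hn G a.1 a.2) =
            borderedMinors hm hn G a.1 a.2 := by simp [hG]
          rw [e]
          refine Ideal.subset_span (Finset.mem_coe.2 (Finset.mem_image_of_mem _ ?_))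
          rw [mem_corner]
          omega) g
  have htp : t ∈ p := by
    have := p.sub_mem (p.mul_mem_left (f ^ k) hg) (hsp ht)
    rwa [sub_sub_cancel] at this
  have hft : f * t = 0 := by
    refine MvPolynomial.funext fun x => ?_
    rw [map_mul, map_zero]
    by_cases hx : MvPolynomial.eval x f = 0
    · rw [hx, zero_mul]
    have hdx : MvPolynomial.eval x f =
        ((toMat x).submatrix (Fin.castLE hm) (Fin.castLE hn)).det := by
      rw [hf, RingHom.map_det]
      congr 1
      ext i j
      simp [hG, toMat]
    -- The completion of the first `r` rows and columns of `x` to a matrix of rank at most `r`.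
    let y : Fin m × Fin n → ℂ := ofMat (((toMat x).submatrix id (Fin.castLE hn)) *
      (((MvPolynomial.eval x f)⁻¹ •
        ((toMat x).submatrix (Fin.castLE hm) (Fin.castLE hn)).adjugate) *
        (toMat x).submatrix (Fin.castLE hm) id))
    have hy : y ∈ rankVariety m n r := ofMat_mul_mem _ _
    have hxy : MvPolynomial.aeval x t = MvPolynomial.aeval y t := by
      refine aeval_eq_of_mem_supported htS fun a ha => ?_
      have h0 := borderedMinors_apply_eq_zero hm hn (toMat x) ha
      rw [borderedMinors, ← hdx, Matrix.sub_apply, sub_eq_zero, Matrix.smul_apply,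
        smul_eq_mul] at h0
      change _ = (((toMat x).submatrix id (Fin.castLE hn)) *
        (((MvPolynomial.eval x f)⁻¹ •
          ((toMat x).submatrix (Fin.castLE hm) (Fin.castLE hn)).adjugate) *
          (toMat x).submatrix (Fin.castLE hm) id)) a.1 a.2
      rw [Matrix.smul_mul, Matrix.mul_smul, Matrix.smul_apply, ← Matrix.mul_assoc, ← h0,
        smul_eq_mul, inv_mul_cancel_left₀ hx]
      rfl
    have := htp y hy
    rw [← hxy, MvPolynomial.aeval_eq_eval] at this
    rw [show MvPolynomial.eval x t = 0 from this, mul_zero]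
  have hf0 : f ≠ 0 := fun h => hfp (h ▸ p.zero_mem)
  rw [(mul_eq_zero.1 hft).resolve_left hf0, sub_zero] at ht
  refine (hq.mem_or_mem (hsq ht)).resolve_left fun h => hfp (hqp ?_)
  exact hq.mem_of_pow_mem _ h

theorem codim_rankVariety (hm : r ≤ m) (hn : r ≤ n) :
    codim (rankVariety m n r) = (m - r) * (n - r) := by
  have h : (idealOf (rankVariety m n r)).height = ((m - r) * (n - r) : ℕ) := by
    refine le_antisymm (height_idealOf_rankVariety_le hm hn) ?_
    rw [idealOf_rankVariety, ← card_corner]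
    exact card_le_height_paramIdeal hm hn _ subset_rfl
  rw [codim, h]
  rfl

end Codim

/-! ### Gradients of the equations of a rank variety -/

section Gradient

theorem rank_add_le {K ι κ : Type*} [Field K] [Fintype ι] [Fintype κ] (A B : Matrix ι κ K) :
    (A + B).rank ≤ A.rank + B.rank := by
  have h : LinearMap.range (A + B).mulVecLin ≤
      LinearMap.range A.mulVecLin ⊔ LinearMap.range B.mulVecLin := by
    rw [Matrix.mulVecLin_add]
    exact LinearMap.range_add_le _ _
  exact (Submodule.finrank_mono h).trans (Submodule.finrank_add_le_finrank_add_finrank _ _)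

theorem derivative_aeval_line {σ : Type*} [Fintype σ] (x v : σ → ℂ) (f : MvPolynomial σ ℂ) :
    (derivative (MvPolynomial.aeval (fun i => C (x i) + X * C (v i)) f)).eval 0 =
      ∑ i, MvPolynomial.eval x (MvPolynomial.pderiv i f) * v i := by
  classical
  have h0 : ∀ g : MvPolynomial σ ℂ,
      (MvPolynomial.aeval (fun i => C (x i) + X * C (v i)) g).eval 0 = MvPolynomial.eval x g := by
    intro g
    exact DFunLike.congr_fun (show (Polynomial.aeval (0 : ℂ)).comp
      (MvPolynomial.aeval (fun i => C (x i) + X * C (v i))) = MvPolynomial.aeval x from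
        MvPolynomial.algHom_ext fun i => by simp) g
  induction f using MvPolynomial.induction_on with
  | C a => simp
  | add p q hp hq => simp only [map_add, eval_add, hp, hq, add_mul, Finset.sum_add_distrib]
  | mul_X p i hp =>
    simp only [map_mul, derivative_mul, eval_add, eval_mul, hp, h0, MvPolynomial.aeval_X,
      Derivation.leibniz, smul_eq_mul, map_add, MvPolynomial.eval_X, add_mul,
      Finset.sum_add_distrib, MvPolynomial.pderiv_X]
    simp [Pi.single_apply, Finset.sum_mul, mul_assoc]
    rw [add_comm]
    congr 1
    exact Finset.sum_congr rfl fun _ _ => by ring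

/-- Elements of `I_V` have zero derivative in the direction of a line contained in `V`. -/
theorem sum_pderiv_mul_eq_zero {σ : Type*} [Fintype σ] {V : Set (σ → ℂ)} {x v : σ → ℂ}
    (h : ∀ ε : ℂ, (fun i => x i + ε * v i) ∈ V) {f : MvPolynomial σ ℂ} (hf : f ∈ idealOf V) :
    ∑ i, MvPolynomial.eval x (MvPolynomial.pderiv i f) * v i = 0 := by
  rw [← derivative_aeval_line]
  have : MvPolynomial.aeval (fun i => C (x i) + X * C (v i)) f = 0 := by
    refine Polynomial.funext fun ε => ?_
    have e := hf _ (h ε)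
    rw [eval_zero, ← e]
    exact DFunLike.congr_fun (show (Polynomial.aeval ε).comp
      (MvPolynomial.aeval (fun i => C (x i) + X * C (v i))) =
        MvPolynomial.aeval fun i => x i + ε * v i from
          MvPolynomial.algHom_ext fun i => by
            simp only [AlgHom.comp_apply, MvPolynomial.aeval_X, map_add, map_mul, aeval_X, aeval_C,
              Algebra.algebraMap_self, RingHom.id_apply]) f
  rw [this]
  simp

variable {m n r : ℕ}

/-- The gradient of `f` at `x`, as a matrix. -/
def gradMat (f : MvPolynomial (Fin m × Fin n) ℂ) (x : Fin m × Fin n → ℂ) :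
    Matrix (Fin m) (Fin n) ℂ :=
  Matrix.of fun i j => MvPolynomial.eval x (MvPolynomial.pderiv (i, j) f)

theorem sum_gradMat_eq_zero {x : Fin m × Fin n → ℂ} {v : Matrix (Fin m) (Fin n) ℂ}
    (h : ∀ ε : ℂ, (toMat x + ε • v).rank ≤ r) {f : MvPolynomial (Fin m × Fin n) ℂ}
    (hf : f ∈ idealOf (rankVariety m n r)) : ∑ i, ∑ j, gradMat f x i j * v i j = 0 := by
  rw [← Fintype.sum_prod_type']
  exact sum_pderiv_mul_eq_zero (v := ofMat v) (fun ε => h ε) hf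

/-- At matrices of rank less than `r`, all gradients vanish, since every rank one direction is
tangent there. -/
theorem gradMat_eq_zero {x : Fin m × Fin n → ℂ} (hx : (toMat x).rank < r)
    {f : MvPolynomial (Fin m × Fin n) ℂ} (hf : f ∈ idealOf (rankVariety m n r)) :
    gradMat f x = 0 := by
  ext i j
  have := sum_gradMat_eq_zero (x := x) (v := Matrix.vecMulVec (Pi.single i 1) (Pi.single j 1))
    (fun ε => by
      refine (rank_add_le _ _).trans ?_
      rw [← Matrix.smul_vecMulVec]
      exact (Nat.add_le_add_left (Matrix.rank_vecMulVec_le _ _) _).trans hx) hf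
  simpa [Matrix.vecMulVec_apply, Pi.single_apply] using this

/-- `W_x`: the matrices whose columns are orthogonal to the columns of `x` and whose rows are
orthogonal to the rows of `x`. -/
def IsNormalTo (x y : Matrix (Fin m) (Fin n) ℂ) : Prop :=
  x.transpose * y = 0 ∧ x * y.transpose = 0

theorem sum_mul_mul_single (D x : Matrix (Fin m) (Fin n) ℂ) (j k : Fin n) :
    ∑ a, ∑ b, D a b * (x * Matrix.single j k (1 : ℂ)) a b = (x.transpose * D) j k := by
  simp only [Matrix.mul_apply, Matrix.single_apply]
  simp [ite_and, mul_comm]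

theorem sum_mul_single_mul (D x : Matrix (Fin m) (Fin n) ℂ) (i k : Fin m) :
    ∑ a, ∑ b, D a b * (Matrix.single i k (1 : ℂ) * x) a b = (x * D.transpose) k i := by
  simp only [Matrix.mul_apply, Matrix.single_apply]
  simp [ite_and, mul_comm]

theorem gradMat_isNormalTo {x : Fin m × Fin n → ℂ} (hx : x ∈ rankVariety m n r)
    {f : MvPolynomial (Fin m × Fin n) ℂ} (hf : f ∈ idealOf (rankVariety m n r)) :
    IsNormalTo (toMat x) (gradMat f x) := by
  constructor
  · ext j k
    rw [← sum_mul_mul_single]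
    refine sum_gradMat_eq_zero (fun ε => ?_) hf
    rw [← Matrix.mul_smul]
    nth_rw 1 [← Matrix.mul_one (toMat x)]
    rw [← Matrix.mul_add]
    exact (Matrix.rank_mul_le_left _ _).trans hx
  · ext k i
    rw [← sum_mul_single_mul]
    refine sum_gradMat_eq_zero (fun ε => ?_) hf
    rw [← Matrix.smul_mul]
    nth_rw 1 [← Matrix.one_mul (toMat x)]
    rw [← Matrix.add_mul]
    exact (Matrix.rank_mul_le_right _ _).trans hx

/-- The matrix `N * (det (P Y Q) • Y - Y Q * adj (P Y Q) * P Y) * M`, whose entries are the minors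
of order `r + 1` of `Y` that border the `r × r` compression `P * Y * Q`. -/
def compressedMinors {R : Type*} [CommRing R] {d e : ℕ} (N : Matrix (Fin d) (Fin m) R)
    (P : Matrix (Fin r) (Fin m) R) (Q : Matrix (Fin n) (Fin r) R) (M : Matrix (Fin n) (Fin e) R)
    (Y : Matrix (Fin m) (Fin n) R) : Matrix (Fin d) (Fin e) R :=
  N * ((P * Y * Q).det • Y - Y * Q * (P * Y * Q).adjugate * (P * Y)) * M

theorem compressedMinors_map {R S : Type*} [CommRing R] [CommRing S] {d e : ℕ} (φ : R →+* S)
    (N : Matrix (Fin d) (Fin m) R) (P : Matrix (Fin r) (Fin m) R) (Q : Matrix (Fin n) (Fin r) R)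
    (M : Matrix (Fin n) (Fin e) R) (Y : Matrix (Fin m) (Fin n) R) :
    (compressedMinors N P Q M Y).map φ =
      compressedMinors (N.map φ) (P.map φ) (Q.map φ) (M.map φ) (Y.map φ) := by
  have h1 : P.map φ * Y.map φ * Q.map φ = φ.mapMatrix (P * Y * Q) := by
    simp [Matrix.map_mul]
  have h2 : ∀ a : R, (a • Y).map φ = φ a • Y.map φ := fun a => by
    ext
    simp
  unfold compressedMinors
  rw [h1, ← RingHom.map_det, ← RingHom.map_adjugate, Matrix.map_mul, Matrix.map_mul,
    Matrix.map_sub _ (map_sub φ), Matrix.map_mul, Matrix.map_mul, Matrix.map_mul, Matrix.map_mul,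
    h2]
  rfl

theorem compressedMinors_mul {R : Type*} [CommRing R] {d e : ℕ}
    (N : Matrix (Fin d) (Fin m) R) (P : Matrix (Fin r) (Fin m) R) (Q : Matrix (Fin n) (Fin r) R)
    (M : Matrix (Fin n) (Fin e) R) (A : Matrix (Fin m) (Fin r) R) (B : Matrix (Fin r) (Fin n) R) :
    compressedMinors N P Q M (A * B) = 0 := by
  have h := mul_adjugate_mul_mul A B (P * A) (B * Q)
  have e1 : P * (A * B) * Q = P * A * (B * Q) := by simp only [Matrix.mul_assoc]
  rw [compressedMinors, e1, Matrix.mul_assoc A B Q, ← Matrix.mul_assoc P A B, h, sub_self,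
    Matrix.mul_zero, Matrix.zero_mul]

/-- If the columns of `N` and `M` are orthogonal to the columns and rows of the rank `r` matrix `x`,
then `N_{*a} * M_{*b}ᵀ` is the gradient at `x` of an equation of `X_r`. -/
theorem exists_gradMat_eq {x : Fin m × Fin n → ℂ} (hx : (toMat x).rank = r) {d e : ℕ}
    {N : Matrix (Fin m) (Fin d) ℂ} {M : Matrix (Fin n) (Fin e) ℂ}
    (hN : (toMat x).transpose * N = 0) (hM : toMat x * M = 0) (a : Fin d) (b : Fin e) :
    ∃ f ∈ idealOf (rankVariety m n r), ∀ i j, gradMat f x i j = N i a * M j b := by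
  obtain ⟨P, Q, hPQ⟩ := exists_mul_mul_eq_one hx.ge
  let c : ℂ →+* MvPolynomial (Fin m × Fin n) ℂ := MvPolynomial.C
  let F := compressedMinors (N.transpose.map c) (P.map c) (Q.map c) (M.map c)
    (Matrix.mvPolynomialX (Fin m) (Fin n) ℂ)
  have hF : ∀ {S : Type} [CommRing S] [Algebra ℂ S] (y : Fin m × Fin n → S),
      MvPolynomial.aeval y (F a b) = compressedMinors (N.transpose.map (algebraMap ℂ S))
        (P.map (algebraMap ℂ S)) (Q.map (algebraMap ℂ S)) (M.map (algebraMap ℂ S))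
          (Matrix.of fun i j => y (i, j)) a b := by
    intro S _ _ y
    have h := compressedMinors_map
      (MvPolynomial.aeval y : MvPolynomial (Fin m × Fin n) ℂ →ₐ[ℂ] S).toRingHom
      (N.transpose.map c) (P.map c) (Q.map c) (M.map c) (Matrix.mvPolynomialX (Fin m) (Fin n) ℂ)
    have hc : ∀ {α β : Type} (A : Matrix α β ℂ), (A.map c).map
        (MvPolynomial.aeval y : MvPolynomial (Fin m × Fin n) ℂ →ₐ[ℂ] S).toRingHom =
          A.map (algebraMap ℂ S) := by
      intro α β A
      ext i j
      simp [c]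
    have hX : (Matrix.mvPolynomialX (Fin m) (Fin n) ℂ).map
        (MvPolynomial.aeval y : MvPolynomial (Fin m × Fin n) ℂ →ₐ[ℂ] S).toRingHom =
          Matrix.of fun i j => y (i, j) := by
      ext i j
      simp
    rw [hc, hc, hc, hc, hX] at h
    rw [← h]
    rfl
  refine ⟨F a b, fun y hy => ?_, fun i j => ?_⟩
  · obtain ⟨A, B, rfl⟩ := exists_ofMat_mul hy
    rw [hF]
    exact congrFun (congrFun (compressedMinors_mul _ _ _ _ A B) a) b
  · have h := derivative_aeval_line x (Pi.single (i, j) 1) (F a b)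
    rw [hF] at h
    have hY : (Matrix.of fun i' j' => C (x (i', j')) + X * C ((Pi.single (i, j) 1 :
        Fin m × Fin n → ℂ) (i', j'))) =
        (toMat x).map (algebraMap ℂ ℂ[X]) + (X : ℂ[X]) • Matrix.single i j (1 : ℂ[X]) := by
      ext1 i' j'
      by_cases h1 : i = i' <;> by_cases h2 : j = j' <;>
        simp [toMat, Pi.single_apply, h1, h2, Ne.symm]
    rw [hY] at h
    have h1 : N.transpose.map (algebraMap ℂ ℂ[X]) * (toMat x).map (algebraMap ℂ ℂ[X]) = 0 := by
      rw [← Matrix.map_mul, ← Matrix.transpose_transpose (toMat x), ← Matrix.transpose_mul, hN]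
      simp
    have h2 : (toMat x).map (algebraMap ℂ ℂ[X]) * M.map (algebraMap ℂ ℂ[X]) = 0 := by
      rw [← Matrix.map_mul, hM]
      simp
    set N₁ := N.transpose.map (algebraMap ℂ ℂ[X])
    set M₁ := M.map (algebraMap ℂ ℂ[X])
    set P₁ := P.map (algebraMap ℂ ℂ[X]) with hP₁
    set Q₁ := Q.map (algebraMap ℂ ℂ[X]) with hQ₁
    set x₁ := (toMat x).map (algebraMap ℂ ℂ[X]) with hx₁
    set v : Matrix (Fin m) (Fin n) ℂ[X] := Matrix.single i j 1
    set Y := x₁ + (X : ℂ[X]) • v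
    have h3 : N₁ * Y = (X : ℂ[X]) • (N₁ * v) := by
      rw [Matrix.mul_add, h1, zero_add, Matrix.mul_smul]
    have h4 : Y * M₁ = (X : ℂ[X]) • (v * M₁) := by
      rw [Matrix.add_mul, h2, zero_add, Matrix.smul_mul]
    have h5 : compressedMinors N₁ P₁ Q₁ M₁ Y = (X : ℂ[X]) • ((P₁ * Y * Q₁).det • (N₁ * v * M₁) -
        (X : ℂ[X]) • (N₁ * v * Q₁ * (P₁ * Y * Q₁).adjugate * (P₁ * (v * M₁)))) := by
      have e1 : N₁ * (Y * Q₁ * (P₁ * Y * Q₁).adjugate * (P₁ * Y)) * M₁ =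
          N₁ * Y * Q₁ * (P₁ * Y * Q₁).adjugate * (P₁ * (Y * M₁)) := by
        simp only [Matrix.mul_assoc]
      rw [compressedMinors, Matrix.mul_sub, Matrix.sub_mul, e1, Matrix.mul_smul, h3, h4,
        Matrix.smul_mul, Matrix.smul_mul, smul_sub]
      simp only [Matrix.smul_mul, Matrix.mul_smul]
      rw [smul_comm]
    have h6 : ((P₁ * Y * Q₁).det).eval 0 = 1 := by
      rw [← Polynomial.coe_evalRingHom, RingHom.map_det, ← Matrix.det_one (n := Fin r), ← hPQ]
      congr 1
      rw [RingHom.mapMatrix_apply, Matrix.map_mul, Matrix.map_mul]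
      congr 2
      · ext; simp [hP₁]
      · ext; simp [Y, hx₁]
      · ext; simp [hQ₁]
    rw [h5] at h
    have h7 : (N₁ * v * M₁) a b = C (N i a * M j b) := by
      simp [Matrix.mul_apply, v, N₁, M₁, Matrix.single_apply, ite_and]
    have h8 : ∑ k, MvPolynomial.eval x (MvPolynomial.pderiv k (F a b)) *
        (Pi.single (i, j) 1 : Fin m × Fin n → ℂ) k = gradMat (F a b) x i j := by
      simp [Pi.single_apply, gradMat]
    rw [h8] at h
    rw [← h, Matrix.smul_apply, Matrix.sub_apply, Matrix.smul_apply, Matrix.smul_apply, h7]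
    simp [h6]

end Gradient

/-! ### Normal spaces -/

section Normal

variable {m n r : ℕ}

theorem le_of_rank_eq {x : Fin m × Fin n → ℂ} (hx : (toMat x).rank = r) :
    r ≤ m ∧ r ≤ n := by
  subst hx
  exact ⟨Matrix.rank_le_height _, Matrix.rank_le_width _⟩

/-- At a matrix `x` of rank `r`, the normal space `W_x` is parametrized by `z ↦ N z Mᵀ`, where the
columns of `N` and `M` are bases of the left and right kernels of `x`; both have a left inverse. -/
theorem exists_normal_param {x : Fin m × Fin n → ℂ} (hx : (toMat x).rank = r) :
    ∃ (N : Matrix (Fin m) (Fin (m - r)) ℂ) (N' : Matrix (Fin (m - r)) (Fin m) ℂ)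
      (M : Matrix (Fin n) (Fin (n - r)) ℂ) (M' : Matrix (Fin (n - r)) (Fin n) ℂ),
      N' * N = 1 ∧ M' * M = 1 ∧ (toMat x).transpose * N = 0 ∧ toMat x * M = 0 ∧
      ∀ y, IsNormalTo (toMat x) y → y = N * (N' * y * M'.transpose) * M.transpose := by
  obtain ⟨hm, hn⟩ := le_of_rank_eq hx
  obtain ⟨N, N', h1, h2, h3⟩ := exists_kernel_matrix (toMat x).transpose (d := m - r) (by
    rw [Matrix.rank_transpose, hx, Fintype.card_fin]; omega)
  obtain ⟨M, M', h4, h5, h6⟩ := exists_kernel_matrix (toMat x) (d := n - r) (by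
    rw [hx, Fintype.card_fin]; omega)
  refine ⟨N, N', M, M', h1, h4, h2, h5, fun y hy => ?_⟩
  have e1 := h3 y hy.1
  have e2 := congrArg Matrix.transpose (h6 y.transpose hy.2)
  rw [Matrix.transpose_mul, Matrix.transpose_mul, Matrix.transpose_transpose] at e2
  calc y = N * (N' * y) := e1.symm
    _ = N * (N' * (y * M'.transpose * M.transpose)) := by rw [e2]
    _ = _ := by simp only [Matrix.mul_assoc]

/-- The gradients of the equations of `X_r` at a matrix of rank `r` span a space of dimension at
least `codim X_r`. -/
theorem exists_minor_ne_zero {x : Fin m × Fin n → ℂ} (hx : (toMat x).rank = r) :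
    ∃ (f : Fin ((m - r) * (n - r)) → idealOf (rankVariety m n r))
      (e : Fin ((m - r) * (n - r)) → Fin m × Fin n),
      (Matrix.of fun i j => ofMat (gradMat (f i : MvPolynomial (Fin m × Fin n) ℂ) x)
        (e j)).det ≠ 0 := by
  obtain ⟨N, N', M, M', h1, h2, h3, h4, -⟩ := exists_normal_param hx
  choose f hf hfg using exists_gradMat_eq hx h3 h4
  let t : Fin ((m - r) * (n - r)) ≃ Fin (m - r) × Fin (n - r) := finProdFinEquiv.symm
  have key : (Matrix.of fun i p => N p.1 (t i).1 * M p.2 (t i).2 :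
      Matrix (Fin ((m - r) * (n - r))) (Fin m × Fin n) ℂ) *
      (Matrix.of fun (p : Fin m × Fin n) i => N' (t i).1 p.1 * M' (t i).2 p.2) = 1 := by
    ext i j
    have e1 := congrFun (congrFun h1 (t j).1) (t i).1
    have e2 := congrFun (congrFun h2 (t j).2) (t i).2
    rw [Matrix.mul_apply] at e1 e2
    rw [Matrix.mul_apply, Fintype.sum_prod_type]
    calc _ = (∑ a, N' (t j).1 a * N a (t i).1) * ∑ b, M' (t j).2 b * M b (t i).2 := by
          rw [Finset.sum_mul_sum]
          exact Finset.sum_congr rfl fun a _ => Finset.sum_congr rfl fun b _ => by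
            simp only [Matrix.of_apply]
            ring
      _ = _ := by
          rw [e1, e2, Matrix.one_apply, Matrix.one_apply, Matrix.one_apply]
          by_cases h : i = j
          · simp [h]
          · have : ¬ ((t j).1 = (t i).1 ∧ (t j).2 = (t i).2) := fun h' =>
              h (t.injective (Prod.ext h'.1.symm h'.2.symm))
            rw [if_neg h]
            by_cases h' : (t j).1 = (t i).1
            · rw [if_neg fun h'' => this ⟨h', h''⟩, mul_zero]
            · rw [if_neg h', zero_mul]
  obtain ⟨e, he⟩ := exists_det_submatrix_ne_zero key
  refine ⟨fun i => ⟨f (t i).1 (t i).2, hf _ _⟩, e, ?_⟩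
  have e1 : (Matrix.of fun i j => ofMat (gradMat (f (t i).1 (t i).2) x) (e j)) =
      (Matrix.of fun i p => N p.1 (t i).1 * M p.2 (t i).2 :
        Matrix (Fin ((m - r) * (n - r))) (Fin m × Fin n) ℂ).submatrix id e := by
    ext i j
    exact hfg _ _ _ _
  rw [e1]
  exact he

/-- The normal space at a matrix of rank `r` has dimension at most `codim X_r`. -/
theorem det_normal_eq_zero {x : Fin m × Fin n → ℂ} (hx : (toMat x).rank = r)
    (y : Fin ((m - r) * (n - r) + 1) → Matrix (Fin m) (Fin n) ℂ)
    (hy : ∀ i, IsNormalTo (toMat x) (y i)) (e : Fin ((m - r) * (n - r) + 1) → Fin m × Fin n) :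
    (Matrix.of fun i j => ofMat (y i) (e j)).det = 0 := by
  obtain ⟨N, N', M, M', -, -, -, -, h⟩ := exists_normal_param hx
  let t : Fin ((m - r) * (n - r)) ≃ Fin (m - r) × Fin (n - r) := finProdFinEquiv.symm
  have key : (Matrix.of fun i j => ofMat (y i) (e j)) =
      (Matrix.of fun i k => (N' * y i * M'.transpose) (t k).1 (t k).2) *
        (Matrix.of fun k j => N (e j).1 (t k).1 * M (e j).2 (t k).2) := by
    ext i j
    rw [Matrix.mul_apply]
    simp only [Matrix.of_apply]
    rw [t.sum_comp fun q => (N' * y i * M'.transpose) q.1 q.2 *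
      (N (e j).1 q.1 * M (e j).2 q.2), Fintype.sum_prod_type_right, ofMat, h _ (hy i), Matrix.mul_apply]
    refine Finset.sum_congr rfl fun b _ => ?_
    rw [Matrix.mul_apply, Finset.sum_mul]
    refine Finset.sum_congr rfl fun a _ => ?_
    rw [Matrix.transpose_apply, ← h _ (hy i)]
    ring
  rw [key]
  exact det_mul_eq_zero_of_lt (Nat.lt_succ_self _) _ _

end Normal

/-! ### Smooth points -/

section Smooth

variable {m n r : ℕ}

theorem mem_smoothLocus {x : Fin m × Fin n → ℂ} (hx : (toMat x).rank = r) :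
    x ∈ smoothLocus (rankVariety m n r) := by
  obtain ⟨hm, hn⟩ := le_of_rank_eq hx
  refine ⟨hx.le, fun h => ?_⟩
  obtain ⟨f, e, hd⟩ := exists_minor_ne_zero hx
  have := h (((jacobian (rankVariety m n r)).submatrix f e).det) (by
    refine Ideal.mem_sup_right (Ideal.subset_span ?_)
    rw [codim_rankVariety hm hn]
    exact ⟨f, e, rfl⟩)
  refine hd ?_
  rw [← this, MvPolynomial.aeval_eq_eval]
  refine Eq.trans ?_ (RingHom.map_det _ _).symm
  rfl

/-- Every normal vector at a point of `X_r` is zero or lies in `W_x`, and then `x` has rank `r`. -/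
theorem span_gradMat {x : Fin m × Fin n → ℂ} (hx : x ∈ rankVariety m n r)
    {y : Matrix (Fin m) (Fin n) ℂ} {k : ℕ} (f : Fin k → idealOf (rankVariety m n r)) (c : Fin k → ℂ)
    (hy : y = ∑ i, c i • gradMat (f i : MvPolynomial (Fin m × Fin n) ℂ) x) :
    y = 0 ∨ ((toMat x).rank = r ∧ IsNormalTo (toMat x) y) := by
  rcases (mem_rankVariety.1 hx).lt_or_eq with h | h
  · left
    rw [hy]
    exact Finset.sum_eq_zero fun i _ => by rw [gradMat_eq_zero h (f i).2, smul_zero]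
  · refine Or.inr ⟨h, ?_, ?_⟩
    · rw [hy, Matrix.mul_sum]
      exact Finset.sum_eq_zero fun i _ => by
        rw [Matrix.mul_smul, (gradMat_isNormalTo hx (f i).2).1, smul_zero]
    · rw [hy, Matrix.transpose_sum, Matrix.mul_sum]
      exact Finset.sum_eq_zero fun i _ => by
        rw [Matrix.transpose_smul, Matrix.mul_smul, (gradMat_isNormalTo hx (f i).2).2, smul_zero]

end Smooth

/-! ### The dual variety of the rank one matrices -/

section Dual

variable {m n r : ℕ}

theorem normal_orthogonal_tangent {x v : Fin m × Fin n → ℂ} (hx : (toMat x).rank = r)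
    {y : Matrix (Fin m) (Fin n) ℂ} (hy : IsNormalTo (toMat x) y)
    (hv : v ∈ tangentSpace (rankVariety m n r) x) : ∑ p, ofMat y p * v p = 0 := by
  obtain ⟨N, N', M, M', -, -, h3, h4, h⟩ := exists_normal_param hx
  choose f hf hfg using exists_gradMat_eq hx h3 h4
  have key : ∀ p, ofMat y p = ∑ a, ∑ b, (N' * y * M'.transpose) a b *
      MvPolynomial.eval x (MvPolynomial.pderiv p (f a b)) := by
    intro p
    rw [ofMat, h y hy, Finset.sum_comm, Matrix.mul_apply, ← h y hy]
    refine Finset.sum_congr rfl fun b _ => ?_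
    rw [Matrix.mul_apply, Finset.sum_mul]
    refine Finset.sum_congr rfl fun a _ => ?_
    have := hfg a b p.1 p.2
    rw [gradMat, Matrix.of_apply] at this
    rw [this, Matrix.transpose_apply]
    ring
  simp only [key, Finset.sum_mul]
  rw [Finset.sum_comm]
  refine Finset.sum_eq_zero fun a _ => ?_
  rw [Finset.sum_comm]
  refine Finset.sum_eq_zero fun b _ => ?_
  simp only [mul_assoc]
  rw [← Finset.mul_sum, hv _ (hf a b), mul_zero]

/-- `X_r` is Zariski closed. -/
theorem zeroLocus_rankVariety :
    MvPolynomial.zeroLocus ℂ (MvPolynomial.vanishingIdeal ℂ (rankVariety m n r)) =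
      rankVariety m n r := by
  refine subset_antisymm (fun y hy => ?_) (MvPolynomial.zeroLocus_vanishingIdeal_le _)
  by_contra hr
  have hr' : r + 1 ≤ (toMat y).rank := Nat.succ_le_of_lt (not_le.1 (mt mem_rankVariety.2 hr))
  obtain ⟨P, Q, hPQ⟩ := exists_mul_mul_eq_one hr'
  let c : ℂ →+* MvPolynomial (Fin m × Fin n) ℂ := MvPolynomial.C
  have hc : ∀ z, MvPolynomial.aeval z
      (P.map c * Matrix.mvPolynomialX (Fin m) (Fin n) ℂ * Q.map c).det =
        (P * toMat z * Q).det := by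
    intro z
    rw [MvPolynomial.aeval_eq_eval]
    refine (RingHom.map_det _ _).trans ?_
    congr 1
    ext i j
    simp [Matrix.mul_apply, c, toMat]
  have h := hy _ (show (P.map c * Matrix.mvPolynomialX (Fin m) (Fin n) ℂ * Q.map c).det ∈
      MvPolynomial.vanishingIdeal ℂ (rankVariety m n r) from fun z hz => by
    obtain ⟨A, B, rfl⟩ := exists_ofMat_mul hz
    rw [hc, toMat_ofMat, ← Matrix.mul_assoc, Matrix.mul_assoc]
    exact det_mul_eq_zero_of_lt (Nat.lt_succ_self _) _ _)
  rw [hc, hPQ, Matrix.det_one] at h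
  exact one_ne_zero h

theorem exists_mulVec_eq_zero_of_rank_lt {ι κ : Type*} [Fintype ι] {A : Matrix κ ι ℂ}
    (h : A.rank < Fintype.card ι) : ∃ v ≠ 0, A.mulVec v = 0 := by
  by_contra! h0
  have hker : LinearMap.ker A.mulVecLin = ⊥ := by
    rw [LinearMap.ker_eq_bot']
    intro v hv
    by_contra hv0
    exact h0 v hv0 hv
  have := LinearMap.finrank_range_add_finrank_ker A.mulVecLin
  rw [hker, finrank_bot, add_zero, Module.finrank_fintype_fun_eq_card] at this
  exact h.ne this

theorem rank_vecMulVec_eq_one {α : Fin m → ℂ} {β : Fin n → ℂ} (hα : α ≠ 0) (hβ : β ≠ 0) :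
    (Matrix.vecMulVec α β).rank = 1 := by
  refine le_antisymm (Matrix.rank_vecMulVec_le _ _) (Nat.one_le_iff_ne_zero.2 fun h => ?_)
  obtain ⟨A, B, hAB⟩ := exists_mul_of_rank_le h.le
  obtain ⟨i, hi⟩ := Function.ne_iff.1 hα
  obtain ⟨j, hj⟩ := Function.ne_iff.1 hβ
  exact mul_ne_zero hi hj ((congrFun (congrFun hAB i) j).trans (by simp [Matrix.mul_apply]))

/-- A matrix is normal to `X_1` at some smooth point exactly if it has a nontrivial left kernel. -/
theorem dualVariety_rankVariety_one (hm : 1 ≤ m) (hmn : m ≤ n) :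
    dualVariety (rankVariety m n 1) = rankVariety m n (m - 1) := by
  rw [← zeroLocus_rankVariety (r := m - 1), dualVariety]
  congr 2
  ext y
  constructor
  · rintro ⟨x, ⟨hx, -⟩, hy⟩
    rcases (mem_rankVariety.1 hx).lt_or_eq with h | h
    · have hy0 : toMat y = 0 := by
        ext i j
        have := hy (Pi.single (i, j) 1) fun f hf => by
          have h0 := congrFun (congrFun (gradMat_eq_zero h hf) i) j
          rw [gradMat, Matrix.of_apply] at h0
          simpa [Pi.single_apply] using h0
        simpa [Pi.single_apply, toMat] using this
      rw [mem_rankVariety, hy0, Matrix.rank_zero]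
      exact Nat.zero_le _
    · have hn : (toMat x).transpose * toMat y = 0 := by
        ext j k
        rw [← sum_mul_mul_single, ← Fintype.sum_prod_type']
        refine hy (ofMat (toMat x * Matrix.single j k 1)) fun f hf => ?_
        have := congrFun (congrFun (gradMat_isNormalTo hx hf).1 j) k
        rw [← sum_mul_mul_single, ← Fintype.sum_prod_type'] at this
        exact this
      have := Matrix.rank_add_rank_le_card_of_mul_eq_zero hn
      rw [Matrix.rank_transpose, h, Fintype.card_fin] at this
      rw [mem_rankVariety]
      omega
  · intro hy
    rw [mem_rankVariety] at hy
    obtain ⟨α, hα, hαy⟩ := exists_mulVec_eq_zero_of_rank_lt (A := (toMat y).transpose) (by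
      rw [Matrix.rank_transpose, Fintype.card_fin]; omega)
    obtain ⟨β, hβ, hβy⟩ := exists_mulVec_eq_zero_of_rank_lt (A := toMat y) (by
      rw [Fintype.card_fin]; omega)
    have h1 : (toMat (ofMat (Matrix.vecMulVec α β))).rank = 1 := rank_vecMulVec_eq_one hα hβ
    refine ⟨ofMat (Matrix.vecMulVec α β), mem_smoothLocus h1, fun v hv => ?_⟩
    refine normal_orthogonal_tangent h1 (y := toMat y) ⟨?_, ?_⟩ hv
    · rw [toMat_ofMat, Matrix.transpose_vecMulVec, Matrix.vecMulVec_mul, ← Matrix.mulVec_transpose,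
        hαy, Matrix.vecMulVec_zero]
    · rw [toMat_ofMat, Matrix.vecMulVec_mul, Matrix.vecMul_transpose, hβy, Matrix.vecMulVec_zero]

end Dual

/-! ### Membership in the critical ideal -/

section Critical

variable {σ : Type*}

theorem eval_inX (x u : σ → ℂ) (p : MvPolynomial σ ℂ) :
    MvPolynomial.eval (Sum.elim x u) (inX p) = MvPolynomial.eval x p := by
  change MvPolynomial.eval _ (MvPolynomial.rename Sum.inl p) = _
  rw [MvPolynomial.eval_rename]
  rfl

theorem eval_inU (x u : σ → ℂ) (p : MvPolynomial σ ℂ) :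
    MvPolynomial.eval (Sum.elim x u) (inU p) = MvPolynomial.eval u p := by
  change MvPolynomial.eval _ (MvPolynomial.rename Sum.inr p) = _
  rw [MvPolynomial.eval_rename]
  rfl

/-- The ideal of `X × ℂ^σ` in `ℂ[x, u]` is generated by `I_X`. -/
theorem mem_map_inX {X : Set (σ → ℂ)} {g : MvPolynomial (σ ⊕ σ) ℂ}
    (h : ∀ x ∈ X, ∀ u, MvPolynomial.eval (Sum.elim x u) g = 0) : g ∈ (idealOf X).map inX := by
  let e : MvPolynomial (σ ⊕ σ) ℂ ≃ₐ[ℂ] MvPolynomial σ (MvPolynomial σ ℂ) :=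
    (MvPolynomial.renameEquiv ℂ (Equiv.sumComm σ σ)).trans (MvPolynomial.sumAlgEquiv ℂ σ σ)
  have he : ∀ p, e (inX p) = MvPolynomial.C p := by
    intro p
    induction p using MvPolynomial.induction_on with
    | C a => simp [e, inX]
    | add p q hp hq => rw [map_add, map_add, hp, hq, map_add]
    | mul_X p i hp =>
      rw [map_mul, map_mul, hp, map_mul]
      simp [e, inX]
  have hev : ∀ (x u : σ → ℂ) (p : MvPolynomial (σ ⊕ σ) ℂ), MvPolynomial.eval u
      (MvPolynomial.map (MvPolynomial.eval x) (e p)) = MvPolynomial.eval (Sum.elim x u) p := by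
    intro x u p
    induction p using MvPolynomial.induction_on with
    | C a => simp [e]
    | add p q hp hq => rw [map_add, map_add, map_add, hp, hq, map_add]
    | mul_X p i hp =>
      rw [map_mul, map_mul, map_mul, hp, map_mul]
      rcases i with i | i <;> simp [e]
  have key : e g ∈ (idealOf X).map (MvPolynomial.C : MvPolynomial σ ℂ →+* _) := by
    rw [MvPolynomial.mem_map_C_iff]
    intro k x hx
    have : MvPolynomial.map (MvPolynomial.eval x) (e g) = 0 :=
      MvPolynomial.funext fun u => by rw [hev, h x hx, map_zero]
    have h2 := congrArg (MvPolynomial.coeff k) this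
    rwa [MvPolynomial.coeff_map, MvPolynomial.coeff_zero] at h2
  have h3 := Ideal.mem_map_of_mem e.symm.toRingEquiv.toRingHom key
  have h4 : e.symm.toRingEquiv.toRingHom.comp MvPolynomial.C = inX :=
    RingHom.ext fun p => (AlgEquiv.symm_apply_eq e).2 (he p).symm
  rw [Ideal.map_map, h4] at h3
  exact (e.symm_apply_apply g) ▸ h3

/-- A polynomial vanishing at all `(x, x + y)` with `x ∈ X` and `y` a combination of gradients at `x`
of elements of `I_X` lies in the critical ideal. Where a maximal minor `μ` of the Jacobian is
invertible, the minors of the augmented Jacobian express all `u_j` through `x` and the `u_j` in the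
columns of `μ`, and the latter are free. -/
theorem mem_criticalIdeal {X : Set (σ → ℂ)} {g : MvPolynomial (σ ⊕ σ) ℂ} [Finite σ]
    (h : ∀ x ∈ X, ∀ (k : ℕ) (f : Fin k → idealOf X) (c : Fin k → ℂ), MvPolynomial.eval
      (Sum.elim x fun j => x j + ∑ i, c i * MvPolynomial.eval x (jacobian X (f i) j)) g = 0) :
    g ∈ criticalIdeal X := by
  set I := (idealOf X).map inX ⊔ minorsIdeal (codim X + 1) (augmentedJacobian X) with hI
  have hS : ∀ (T : Set (σ ⊕ σ)), Set.range Sum.inl ⊆ T → ∀ p : MvPolynomial σ ℂ,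
      inX p ∈ MvPolynomial.supported ℂ T := by
    classical
    intro T hT p
    rw [MvPolynomial.mem_supported]
    intro i hi
    have := MvPolynomial.vars_rename Sum.inl p hi
    obtain ⟨a, -, rfl⟩ := Finset.mem_image.1 this
    exact hT ⟨a, rfl⟩
  have hle : (singIdeal X).map inX ≤
      Ideal.radical (Submodule.comap (LinearMap.mulLeft (MvPolynomial (σ ⊕ σ) ℂ) g) I) := by
    rw [Ideal.map_le_iff_le_comap, singIdeal]
    refine sup_le (fun p hp => ?_) ?_
    · refine Ideal.le_radical ?_
      exact I.mul_mem_left g (Ideal.mem_sup_left (Ideal.mem_map_of_mem _ hp))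
    · rw [minorsIdeal, Ideal.span_le]
      rintro d ⟨f, e, rfl⟩
      set d := ((jacobian X).submatrix f e).det with hd
      set T : Set (σ ⊕ σ) := Set.range Sum.inl ∪ Set.range (Sum.inr ∘ e) with hT
      have hXT : ∀ p, inX p ∈ MvPolynomial.supported ℂ T := hS T Set.subset_union_left
      -- The minor of the augmented Jacobian with the rows of `d`, its columns and the column `j`.
      let A : σ → Matrix (Fin (codim X + 1)) (Fin (codim X + 1)) (MvPolynomial (σ ⊕ σ) ℂ) :=
        fun j => (augmentedJacobian X).submatrix (Fin.cons none (some ∘ f)) (Fin.cons j e)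
      let I' := (idealOf X).map inX ⊔ Ideal.span (Set.range fun j => (A j).det)
      have hI' : I' ≤ I := by
        refine sup_le_sup_left (Ideal.span_le.2 ?_) _
        rintro _ ⟨j, rfl⟩
        exact Ideal.subset_span ⟨_, _, rfl⟩
      have hvar : ∀ i, ∃ s ∈ MvPolynomial.supported ℂ T,
          inX d * MvPolynomial.X i - s ∈ I' := by
        rintro (i | j)
        · exact ⟨inX d * MvPolynomial.X (Sum.inl i), mul_mem (hXT _)
            (MvPolynomial.X_mem_supported.2 (Or.inl ⟨i, rfl⟩)), by simp⟩
        · refine ⟨inX d * MvPolynomial.X (Sum.inr j) - (A j).det, ?_, by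
            rw [sub_sub_cancel]
            exact Ideal.mem_sup_right (Ideal.subset_span ⟨j, rfl⟩)⟩
          have h0 : (A j).det = (MvPolynomial.X (Sum.inr j) - MvPolynomial.X (Sum.inl j)) * inX d +
              ∑ k : Fin (codim X), (-1) ^ (k.succ : ℕ) * (A j) 0 k.succ *
                ((A j).submatrix Fin.succ k.succ.succAbove).det := by
            rw [Matrix.det_succ_row_zero, Fin.sum_univ_succ]
            congr 1
            rw [hd, RingHom.map_det, Fin.val_zero, pow_zero, one_mul]
            rfl
          rw [h0, show ∀ a b c t : MvPolynomial (σ ⊕ σ) ℂ, a * b - ((b - c) * a + t) = a * c - t from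
            fun a b c t => by ring]
          refine sub_mem (mul_mem (hXT _) (MvPolynomial.X_mem_supported.2 (Or.inl ⟨j, rfl⟩)))
            (sum_mem fun k _ => mul_mem (mul_mem (pow_mem (neg_mem (one_mem _)) _) ?_) ?_)
          · exact sub_mem (MvPolynomial.X_mem_supported.2 (Or.inr ⟨k, rfl⟩))
              (MvPolynomial.X_mem_supported.2 (Or.inl ⟨e k, rfl⟩))
          · exact det_mem_subalgebra fun a b => hXT _
      obtain ⟨k, s, hs, hks⟩ := exists_pow_mul_sub_mem (hXT d) hvar g
      have hds : inX d * s ∈ (idealOf X).map inX := by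
        -- The `u_j` in the columns of `d` can be prescribed, and `s` involves no others.
        refine mem_map_inX fun x hx u => ?_
        rw [map_mul, eval_inX]
        by_cases hdx : MvPolynomial.eval x d = 0
        · rw [hdx, zero_mul]
        set M : Matrix (Fin (codim X)) (Fin (codim X)) ℂ :=
          Matrix.of fun i j => MvPolynomial.eval x (jacobian X (f i) (e j)) with hM
        have hMd : M.det = MvPolynomial.eval x d := (RingHom.map_det _ _).symm
        let c := Matrix.vecMul (fun j => u (e j) - x (e j)) M⁻¹
        have hc : ∀ j, x (e j) + ∑ i, c i * MvPolynomial.eval x (jacobian X (f i) (e j)) =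
            u (e j) := by
          intro j
          have h1 : Matrix.vecMul c M = fun j => u (e j) - x (e j) := by
            rw [Matrix.vecMul_vecMul, Matrix.nonsing_inv_mul _ (by rw [hMd]; exact IsUnit.mk0 _ hdx),
              Matrix.vecMul_one]
          have h2 := congrFun h1 j
          exact (add_comm _ _).trans (eq_sub_iff_add_eq.1 h2)
        set u' : σ → ℂ := fun j => x j + ∑ i, c i * MvPolynomial.eval x (jacobian X (f i) j) with hu'
        have e1 : MvPolynomial.eval (Sum.elim x u) s = MvPolynomial.eval (Sum.elim x u') s := by
          rw [← MvPolynomial.aeval_eq_eval, ← MvPolynomial.aeval_eq_eval]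
          refine aeval_eq_of_mem_supported hs ?_
          rintro _ (⟨i, rfl⟩ | ⟨j, rfl⟩)
          · rfl
          · exact (hc j).symm
        have e2 : I' ≤ RingHom.ker (MvPolynomial.eval (Sum.elim x u')) := by
          refine sup_le ?_ ?_
          · rw [Ideal.map_le_iff_le_comap]
            intro p hp
            rw [Ideal.mem_comap, RingHom.mem_ker, eval_inX]
            exact hp x hx
          · rw [Ideal.span_le]
            rintro _ ⟨j, rfl⟩
            rw [SetLike.mem_coe, RingHom.mem_ker, RingHom.map_det, ← Matrix.exists_vecMul_eq_zero_iff]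
            refine ⟨Fin.cons (-1) c, fun h0 => ?_, ?_⟩
            · have := congrFun h0 0
              simp at this
            · ext b
              rw [Matrix.vecMul, dotProduct, Fin.sum_univ_succ]
              simp only [A, RingHom.mapMatrix_apply, Matrix.map_apply, Matrix.submatrix_apply,
                Fin.cons_zero, Fin.cons_succ, augmentedJacobian, Matrix.of_apply, map_sub,
                MvPolynomial.eval_X, Sum.elim_inl, Sum.elim_inr, Function.comp_apply, eval_inX, hu']
              simp
        have e3 := e2 hks
        rw [RingHom.mem_ker, map_sub, map_mul, h x hx _ f c, mul_zero, zero_sub, neg_eq_zero] at e3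
        rw [e1, e3, mul_zero]
      refine ⟨k + 1, ?_⟩
      change g * inX d ^ (k + 1) ∈ I
      have := I.add_mem (I.mul_mem_left (inX d) (hI' hks))
        (show inX d * s ∈ I from Ideal.mem_sup_left hds)
      convert this using 1
      ring
  obtain ⟨k, hk⟩ := Ideal.exists_pow_le_of_le_radical_of_fg hle (IsNoetherian.noetherian _)
  exact ⟨k, fun p hp => hk hp⟩

end Critical

/-! ### The critical ideal of a rank variety -/

section CriticalRank

variable {m n r : ℕ}

/-- At a point of rank `r` the saturation is harmless, and the minors of the augmented Jacobian vanish
there because the normal space has dimension `codim X_r`. -/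
theorem eval_eq_zero_of_mem_criticalIdeal {g : MvPolynomial ((Fin m × Fin n) ⊕ (Fin m × Fin n)) ℂ}
    (hg : g ∈ criticalIdeal (rankVariety m n r)) {x y : Fin m × Fin n → ℂ}
    (hx : (toMat x).rank = r) (hy : IsNormalTo (toMat x) (toMat y)) :
    MvPolynomial.eval (Sum.elim x (x + y)) g = 0 := by
  obtain ⟨hm, hn⟩ := le_of_rank_eq hx
  obtain ⟨k, hk⟩ := hg
  obtain ⟨-, hs⟩ := mem_smoothLocus hx
  rw [MvPolynomial.mem_zeroLocus_iff] at hs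
  push Not at hs
  obtain ⟨p, hp, hpx⟩ := hs
  have hI : (idealOf (rankVariety m n r)).map inX ⊔ minorsIdeal (codim (rankVariety m n r) + 1)
      (augmentedJacobian (rankVariety m n r)) ≤
        RingHom.ker (MvPolynomial.eval (Sum.elim x (x + y))) := by
    refine sup_le ?_ ?_
    · rw [Ideal.map_le_iff_le_comap]
      intro p hp
      rw [Ideal.mem_comap, RingHom.mem_ker, eval_inX]
      exact hp x hx.le
    · rw [minorsIdeal, Ideal.span_le, codim_rankVariety hm hn]
      rintro _ ⟨f, e, rfl⟩
      rw [SetLike.mem_coe, RingHom.mem_ker, RingHom.map_det]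
      let z : Option (idealOf (rankVariety m n r)) → Matrix (Fin m) (Fin n) ℂ := fun o =>
        o.elim (toMat y) fun f => gradMat (f : MvPolynomial (Fin m × Fin n) ℂ) x
      have hz : ∀ o, IsNormalTo (toMat x) (z o) := by
        rintro (_ | f)
        exacts [hy, gradMat_isNormalTo hx.le f.2]
      rw [← det_normal_eq_zero hx (fun i => z (f i)) (fun i => hz _) e]
      congr 1
      ext i j
      rw [RingHom.mapMatrix_apply, Matrix.map_apply, Matrix.submatrix_apply, augmentedJacobian,
        Matrix.of_apply, Matrix.of_apply]
      rcases f i with _ | f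
      · simp [z, ofMat, toMat]
      · exact eval_inX _ _ _
  have h := hI (hk _ (Ideal.pow_mem_pow (Ideal.mem_map_of_mem _ hp) k))
  rw [RingHom.mem_ker, map_mul, map_pow, eval_inX] at h
  exact (mul_eq_zero.1 h).resolve_right (pow_ne_zero _ hpx)

theorem mem_criticalIdeal_rankVariety
    {g : MvPolynomial ((Fin m × Fin n) ⊕ (Fin m × Fin n)) ℂ}
    (h : ∀ x y : Fin m × Fin n → ℂ, x ∈ rankVariety m n r →
      (y = 0 ∨ ((toMat x).rank = r ∧ IsNormalTo (toMat x) (toMat y))) →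
        MvPolynomial.eval (Sum.elim x (x + y)) g = 0) :
    g ∈ criticalIdeal (rankVariety m n r) := by
  refine mem_criticalIdeal fun x hx k f c => ?_
  refine h x (fun j => ∑ i, c i * MvPolynomial.eval x (jacobian (rankVariety m n r) (f i) j)) hx ?_
  refine (span_gradMat hx f c ?_).imp (fun h0 => congrArg ofMat h0) id
  ext a b
  rw [Matrix.sum_apply]
  rfl

end CriticalRank

/-! ### The elimination ideal -/

section EliminationIdeal

theorem exists_eq_comp_sq {R : Type*} [CommRing R] (G : R[X]) :
    ∃ A B : R[X], G = A.comp (X ^ 2) + X * B.comp (X ^ 2) := by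
  induction G using Polynomial.induction_on' with
  | add p q hp hq =>
    obtain ⟨A, B, rfl⟩ := hp
    obtain ⟨A', B', rfl⟩ := hq
    exact ⟨A + A', B + B', by rw [add_comp, add_comp]; ring⟩
  | monomial k a =>
    obtain ⟨l, rfl | rfl⟩ := k.even_or_odd'
    · exact ⟨C a * X ^ l, 0, by simp [← C_mul_X_pow_eq_monomial, ← pow_mul]⟩
    · exact ⟨0, C a * X ^ l, by simp [← C_mul_X_pow_eq_monomial, ← pow_mul]; ring⟩

/-- In `R[t] / (I, t² - q)`, which is free over `R / I` on `1, t`, an element `A(t²) + t B(t²)`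
vanishes only if `A(q)` and `B(q)` do. Here this is seen by letting `t` act as the matrix
`!![0, q; 1, 0]`. -/
theorem eval_mem_of_comp_sq_mem {R : Type*} [CommRing R] {I : Ideal R} {q : R} {A B : R[X]}
    (h : A.comp (X ^ 2) + X * B.comp (X ^ 2) ∈
      I.map (C : R →+* R[X]) ⊔ Ideal.span {X ^ 2 - C q}) : A.eval q ∈ I ∧ B.eval q ∈ I := by
  let φ : R →+* R ⧸ I := Ideal.Quotient.mk I
  let T : Matrix (Fin 2) (Fin 2) (R ⧸ I) := !![0, φ q; 1, 0]
  let Φ : R[X] →ₐ[R] Matrix (Fin 2) (Fin 2) (R ⧸ I) := aeval T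
  have hT : T ^ 2 = algebraMap R _ q := by
    rw [pow_two, Matrix.algebraMap_eq_diagonal]
    ext i j
    fin_cases i <;> fin_cases j <;> simp [T, φ]
  have hΦ : ∀ P : R[X], Φ (P.comp (X ^ 2)) = algebraMap R _ (P.eval q) := by
    intro P
    rw [show Φ (P.comp (X ^ 2)) = aeval (T ^ 2) P by simp [Φ, aeval_comp], hT,
      aeval_algebraMap_apply, coe_aeval_eq_eval]
  have hle : I.map (C : R →+* R[X]) ⊔ Ideal.span {X ^ 2 - C q} ≤ RingHom.ker Φ := by
    refine sup_le ?_ ?_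
    · rw [Ideal.map_le_iff_le_comap]
      intro a ha
      rw [Ideal.mem_comap, RingHom.mem_ker, aeval_C, Matrix.algebraMap_eq_diagonal]
      have : Ideal.Quotient.mk I a = 0 := Ideal.Quotient.eq_zero_iff_mem.2 ha
      ext i j
      fin_cases i <;> fin_cases j <;> simp [this]
    · rw [Ideal.span_singleton_le_iff_mem, RingHom.mem_ker, map_sub, map_pow, aeval_X, aeval_C, hT,
        sub_self]
  have h0 := hle h
  rw [RingHom.mem_ker, map_add, map_mul, hΦ, hΦ, aeval_X, Algebra.algebraMap_eq_smul_one,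
    Algebra.algebraMap_eq_smul_one, mul_smul_comm, mul_one] at h0
  have h1 := congrFun (congrFun h0 0) 0
  have h2 := congrFun (congrFun h0 1) 0
  rw [Matrix.add_apply, Matrix.smul_apply, Matrix.smul_apply] at h1 h2
  simp [T, Algebra.smul_def] at h1 h2
  exact ⟨Ideal.Quotient.eq_zero_iff_mem.1 h1, Ideal.Quotient.eq_zero_iff_mem.1 h2⟩

/-- `P(t²)` is the ED polynomial of `X` if, in `ℂ[x, u]` modulo the critical ideal, the squared
distance is a root of `P` and each polynomial over `ℂ[u]` with this root is a multiple of `P`. -/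
theorem isEDPoly_of_forall_dvd {σ : Type*} [Fintype σ] {X : Set (σ → ℂ)}
    {P : (MvPolynomial σ ℂ)[X]} (hP : (P.map inU).eval (sqDist σ) ∈ criticalIdeal X)
    (hdvd : ∀ Q : (MvPolynomial σ ℂ)[X], (Q.map inU).eval (sqDist σ) ∈ criticalIdeal X → P ∣ Q) :
    IsEDPoly X (P.comp (Polynomial.X ^ 2)) := by
  have hmap : ∀ Q : (MvPolynomial σ ℂ)[X], (Q.comp (Polynomial.X ^ 2)).map inU =
      (Q.map inU).comp (Polynomial.X ^ 2) := by
    intro Q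
    rw [Polynomial.map_comp, Polynomial.map_pow, Polynomial.map_X]
  refine ⟨⟨P, rfl⟩, le_antisymm (fun G hG => ?_) ?_⟩
  · obtain ⟨A, B, rfl⟩ := exists_eq_comp_sq G
    rw [eliminationIdeal, Ideal.mem_comap, coe_mapRingHom, Polynomial.map_add, Polynomial.map_mul,
      hmap, hmap, Polynomial.map_X] at hG
    obtain ⟨hA, hB⟩ := eval_mem_of_comp_sq_mem hG
    obtain ⟨A', rfl⟩ := hdvd A hA
    obtain ⟨B', rfl⟩ := hdvd B hB
    rw [Ideal.mem_span_singleton]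
    exact ⟨A'.comp (Polynomial.X ^ 2) + Polynomial.X * B'.comp (Polynomial.X ^ 2), by
      rw [mul_comp, mul_comp]; ring⟩
  · rw [Ideal.span_singleton_le_iff_mem, eliminationIdeal, Ideal.mem_comap, coe_mapRingHom, hmap]
    have h1 : Polynomial.X ^ 2 - C (sqDist σ) ∣
        (P.map inU).comp (Polynomial.X ^ 2) - C ((P.map inU).eval (sqDist σ)) := by
      have h := sub_dvd_eval_sub (Polynomial.X ^ 2) (C (sqDist σ)) ((P.map inU).map C)
      rwa [eval_map, eval_map, ← Polynomial.comp, ← Polynomial.comp, comp_C] at h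
    rw [← sub_add_cancel ((P.map inU).comp (Polynomial.X ^ 2)) (C ((P.map inU).eval (sqDist σ)))]
    exact Ideal.add_mem _ (Ideal.mem_sup_right (Ideal.mem_span_singleton.2 h1))
      (Ideal.mem_sup_left (Ideal.mem_map_of_mem _ hP))

end EliminationIdeal

/-! ### Critical points from eigenvectors of the Gram matrix -/

section SpectralPairs

variable {m n : ℕ}

theorem sum_ofMat_sq (x : Matrix (Fin m) (Fin n) ℂ) :
    ∑ p, ofMat x p ^ 2 = (x * x.transpose).trace := by
  simp [Fintype.sum_prod_type, Matrix.trace, Matrix.mul_apply, ofMat, pow_two]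

theorem trace_vecMulVec_mul_transpose (α : Fin m → ℂ) (β : Fin n → ℂ) :
    (Matrix.vecMulVec α β * (Matrix.vecMulVec α β).transpose).trace = (α ⬝ᵥ α) * (β ⬝ᵥ β) := by
  rw [Matrix.transpose_vecMulVec, Matrix.vecMulVec_mul_vecMulVec, Matrix.vecMulVec_smul,
    Matrix.trace_smul, Matrix.trace_vecMulVec, smul_eq_mul, mul_comm]

theorem IsNormalTo.symm {x y : Matrix (Fin m) (Fin n) ℂ} (h : IsNormalTo x y) : IsNormalTo y x := by
  constructor
  · rw [← Matrix.transpose_transpose x, ← Matrix.transpose_mul, h.1, Matrix.transpose_zero]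
  · rw [← Matrix.transpose_transpose y, ← Matrix.transpose_mul, h.2, Matrix.transpose_zero]

theorem trace_add_mul_transpose {x y : Matrix (Fin m) (Fin n) ℂ} (h : IsNormalTo x y) :
    ((x + y) * (x + y).transpose).trace = (x * x.transpose).trace + (y * y.transpose).trace := by
  rw [Matrix.transpose_add, Matrix.add_mul, Matrix.mul_add, Matrix.mul_add, h.2, h.symm.2, add_zero,
    zero_add, Matrix.trace_add]

/-- If `αβᵀ` is normal to `w`, then `α` is an eigenvector of `u uᵀ` for `u = αβᵀ + w`, with
eigenvalue `q(αβᵀ)`. -/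
theorem det_sub_eq_zero {α : Fin m → ℂ} {β : Fin n → ℂ} {w : Matrix (Fin m) (Fin n) ℂ}
    (hα : α ≠ 0) (h₁ : w.transpose.mulVec α = 0) (h₂ : w.mulVec β = 0) :
    ((Matrix.vecMulVec α β + w) * (Matrix.vecMulVec α β + w).transpose -
      Matrix.scalar (Fin m) ((α ⬝ᵥ α) * (β ⬝ᵥ β))).det = 0 := by
  rw [← Matrix.exists_mulVec_eq_zero_iff]
  refine ⟨α, hα, ?_⟩
  have h₃ : (Matrix.vecMulVec α β + w).transpose.mulVec α = (α ⬝ᵥ α) • β := by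
    rw [Matrix.transpose_add, Matrix.add_mulVec, h₁, add_zero, Matrix.transpose_vecMulVec,
      Matrix.vecMulVec_mulVec]
    simp
  rw [Matrix.sub_mulVec, ← Matrix.mulVec_mulVec, h₃, Matrix.mulVec_smul, Matrix.add_mulVec, h₂,
    Matrix.vecMulVec_mulVec]
  ext i
  simp [Matrix.scalar_apply]
  ring

theorem mulVec_eq_zero_of_isNormalTo {α : Fin m → ℂ} {β : Fin n → ℂ}
    {w : Matrix (Fin m) (Fin n) ℂ} (hα : α ≠ 0) (h : w * (Matrix.vecMulVec α β).transpose = 0) :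
    w.mulVec β = 0 := by
  rw [Matrix.transpose_vecMulVec, Matrix.mul_vecMulVec] at h
  obtain ⟨i, hi⟩ := Function.ne_iff.1 hα
  ext j
  exact (mul_eq_zero.1 (congrFun (congrFun h j) i)).resolve_right hi

/-- A unit eigenvector `α` of `u uᵀ` splits `u` into the singular component `α αᵀ u` and its
complement; these are the critical points of the distance from `u` on `X_1` and `X_{m-1}`. -/
theorem exists_critical_pair {u : Matrix (Fin m) (Fin n) ℂ} {α : Fin m → ℂ} {l : ℂ}
    (hα : α ⬝ᵥ α = 1) (hl : (u * u.transpose).mulVec α = l • α) (hl0 : l ≠ 0)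
    (hu : (u * u.transpose).det ≠ 0) :
    ∃ z w : Matrix (Fin m) (Fin n) ℂ, u = z + w ∧ z.rank = 1 ∧ w.rank = m - 1 ∧ IsNormalTo z w ∧
      IsNormalTo w z ∧ (z * z.transpose).trace = l ∧
        (w * w.transpose).trace = (u * u.transpose).trace - l := by
  set β := u.transpose.mulVec α with hβ
  have hα0 : α ≠ 0 := by
    rintro rfl
    simp at hα
  have huβ : u.mulVec β = l • α := by rw [hβ, Matrix.mulVec_mulVec, hl]
  have hββ : β ⬝ᵥ β = l := by
    rw [hβ, Matrix.dotProduct_mulVec, Matrix.vecMul_transpose, ← hβ, huβ, smul_dotProduct, hα,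
      smul_eq_mul, mul_one]
  have hβ0 : β ≠ 0 := by
    intro h
    rw [h, dotProduct_zero] at hββ
    exact hl0 hββ.symm
  set z := Matrix.vecMulVec α β with hz
  have h1 : (u - z).transpose.mulVec α = 0 := by
    rw [Matrix.transpose_sub, Matrix.sub_mulVec, ← hβ, hz, Matrix.transpose_vecMulVec,
      Matrix.vecMulVec_mulVec, hα]
    simp
  have h2 : (u - z).mulVec β = 0 := by
    rw [Matrix.sub_mulVec, huβ, hz, Matrix.vecMulVec_mulVec, hββ]
    simp
  have hwz : IsNormalTo (u - z) z := by
    constructor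
    · rw [hz, Matrix.mul_vecMulVec, ← hz, h1, Matrix.zero_vecMulVec]
    · rw [hz, Matrix.transpose_vecMulVec, Matrix.mul_vecMulVec, ← hz, h2, Matrix.zero_vecMulVec]
  have hzw : IsNormalTo z (u - z) := hwz.symm
  have hzl : (z * z.transpose).trace = l := by
    rw [hz, trace_vecMulVec_mul_transpose, hα, hββ, one_mul]
  have hrz : z.rank = 1 := rank_vecMulVec_eq_one hα0 hβ0
  refine ⟨z, u - z, by simp, hrz, ?_, hzw, hwz, hzl, ?_⟩
  · have e1 := Matrix.rank_add_rank_le_card_of_mul_eq_zero hwz.1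
    rw [Matrix.rank_transpose, hrz, Fintype.card_fin] at e1
    have e2 := rank_add_le z (u - z)
    rw [add_sub_cancel, hrz] at e2
    have e3 := Matrix.rank_of_det_ne_zero hu
    rw [Fintype.card_fin] at e3
    have e4 := Matrix.rank_mul_le_left u u.transpose
    omega
  · have := trace_add_mul_transpose hzw
    rw [add_sub_cancel, hzl] at this
    rw [this, add_sub_cancel_left]

/-- The spectral theorem for the real matrix `v vᵀ`, with the eigenvectors normalized for the bilinear
form. -/
theorem exists_eigenvectors (v : Matrix (Fin m) (Fin n) ℝ)
    (hs : (v.map Complex.ofReal * (v.map Complex.ofReal).transpose).charpoly.Separable) :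
    ∃ (l : Fin m → ℂ) (α : Fin m → Fin m → ℂ), Function.Injective l ∧ (∀ i, α i ⬝ᵥ α i = 1) ∧
      ∀ i, (v.map Complex.ofReal * (v.map Complex.ofReal).transpose).mulVec (α i) = l i • α i := by
  have hH : (v * v.transpose).IsHermitian := by
    rw [Matrix.IsHermitian, Matrix.conjTranspose_eq_transpose_of_trivial, Matrix.transpose_mul,
      Matrix.transpose_transpose]
  have hmap : v.map Complex.ofReal * (v.map Complex.ofReal).transpose =
      (v * v.transpose).map Complex.ofRealHom := by
    rw [Matrix.map_mul]
    rfl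
  refine ⟨fun i => hH.eigenvalues i, fun i j => (hH.eigenvectorBasis i j : ℂ), ?_, fun i => ?_,
    fun i => ?_⟩
  · rw [hmap, Matrix.charpoly_map, hH.charpoly_eq, Polynomial.map_prod] at hs
    simp only [Polynomial.map_sub, Polynomial.map_X, Polynomial.map_C] at hs
    exact separable_prod_X_sub_C_iff.1 hs
  · have h := hH.eigenvectorBasis.orthonormal.1 i
    have h2 := EuclideanSpace.real_norm_sq_eq (hH.eigenvectorBasis i)
    rw [h, one_pow] at h2
    rw [dotProduct, ← Complex.ofReal_one, h2, Complex.ofReal_sum]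
    exact Finset.sum_congr rfl fun j _ => by rw [pow_two, Complex.ofReal_mul]
  · have h := hH.mulVec_eigenvectorBasis i
    rw [hmap]
    ext j
    have h2 := congrArg Complex.ofReal (congrFun h j)
    simp only [Matrix.mulVec, dotProduct, Complex.ofReal_sum, Complex.ofReal_mul, Pi.smul_apply,
      smul_eq_mul] at h2 ⊢
    exact h2

end SpectralPairs

/-! ### Divisibility from generic roots -/

section Divisibility

/-- A monic polynomial `P` over `ℂ[u]` divides `Q` if, for all real `u` outside a hypersurface, `P`
and `Q` have `deg P` common roots: the remainder of `Q` then vanishes on a Zariski dense set. -/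
theorem dvd_of_generic_roots {σ : Type*} {k : ℕ} {P Q : (MvPolynomial σ ℂ)[X]} (hP : P.Monic)
    (hk : P.natDegree = k) {D : MvPolynomial σ ℂ} (hD : D ≠ 0)
    (h : ∀ v : σ → ℝ, MvPolynomial.eval (fun i => (v i : ℂ)) D ≠ 0 →
      ∃ l : Fin k → ℂ, Function.Injective l ∧
        ∀ i, (P.map (MvPolynomial.eval fun i => (v i : ℂ))).eval (l i) = 0 ∧
          (Q.map (MvPolynomial.eval fun i => (v i : ℂ))).eval (l i) = 0) : P ∣ Q := by
  rw [← Polynomial.modByMonic_eq_zero_iff_dvd hP]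
  ext1 j
  rw [coeff_zero]
  refine (mul_eq_zero.1 (?_ : D * (Q %ₘ P).coeff j = 0)).resolve_left hD
  refine MvPolynomial.funext_set (fun _ => Set.range Complex.ofReal)
    (fun _ => Set.infinite_range_of_injective Complex.ofReal_injective) fun x hx => ?_
  choose v hv using fun i => hx i (Set.mem_univ i)
  obtain rfl : (fun i => (v i : ℂ)) = x := funext hv
  rw [map_mul, map_zero]
  by_cases hDv : MvPolynomial.eval (fun i => (v i : ℂ)) D = 0
  · rw [hDv, zero_mul]
  obtain ⟨l, hl, hroot⟩ := h v hDv
  have h0 : (Q %ₘ P).map (MvPolynomial.eval fun i => (v i : ℂ)) = 0 := by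
    refine Polynomial.eq_zero_of_degree_lt_of_eval_index_eq_zero (s := Finset.univ) (v := l)
      hl.injOn ?_ fun i _ => ?_
    · rw [Finset.card_univ, Fintype.card_fin, ← hk, ← degree_eq_natDegree hP.ne_zero]
      exact (degree_map_le).trans_lt (degree_modByMonic_lt _ hP)
    · have := congrArg (fun p => (p.map (MvPolynomial.eval fun i => (v i : ℂ))).eval (l i))
        (modByMonic_add_div Q P)
      simpa [hroot i] using this
  have h1 := congrArg (fun p => p.coeff j) h0
  simp only [coeff_map, coeff_zero] at h1
  rw [h1, mul_zero]

end Divisibility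

/-! ### The generic Gram matrix -/

section Gram

variable {m n r : ℕ}

/-- The generic Gram matrix `U Uᵀ` over `ℂ[u]`. -/
def gram (m n : ℕ) : Matrix (Fin m) (Fin m) (MvPolynomial (Fin m × Fin n) ℂ) :=
  Matrix.mvPolynomialX (Fin m) (Fin n) ℂ * (Matrix.mvPolynomialX (Fin m) (Fin n) ℂ).transpose

theorem gram_map (u : Fin m × Fin n → ℂ) :
    (gram m n).map (MvPolynomial.eval u) = toMat u * (toMat u).transpose := by
  ext i j
  simp [gram, Matrix.mul_apply, toMat]

/-- A polynomial in `u` that is nonzero exactly where `U Uᵀ` has `m` distinct nonzero eigenvalues. The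
degrees of the resultant are prescribed so that it commutes with specialization. -/
def gramDisc (m n : ℕ) : MvPolynomial (Fin m × Fin n) ℂ :=
  resultant (gram m n).charpoly (derivative (gram m n).charpoly) m (m - 1) * (gram m n).det

theorem eval_gramDisc_ne_zero_iff (u : Fin m × Fin n → ℂ) :
    MvPolynomial.eval u (gramDisc m n) ≠ 0 ↔
      (toMat u * (toMat u).transpose).charpoly.Separable ∧
        (toMat u * (toMat u).transpose).det ≠ 0 := by
  have hd : (toMat u * (toMat u).transpose).charpoly.natDegree = m := by
    rw [Matrix.charpoly_natDegree_eq_dim, Fintype.card_fin]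
  have hd' : (derivative (toMat u * (toMat u).transpose).charpoly).natDegree = m - 1 := by
    rw [natDegree_derivative, hd]
  have h1 : MvPolynomial.eval u
      (resultant (gram m n).charpoly (derivative (gram m n).charpoly) m (m - 1)) =
      resultant (toMat u * (toMat u).transpose).charpoly
        (derivative (toMat u * (toMat u).transpose).charpoly) := by
    rw [← resultant_map_map, ← derivative_map, ← Matrix.charpoly_map, gram_map, hd', hd]
  rw [gramDisc, map_mul, mul_ne_zero_iff, h1, RingHom.map_det, RingHom.mapMatrix_apply, gram_map,
    ne_eq, resultant_eq_zero_iff, not_and, not_not, Separable]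
  refine and_congr_left fun _ => ⟨fun h => h (Or.inl (Matrix.charpoly_monic _).ne_zero),
    fun h _ => h⟩

theorem gramDisc_ne_zero (hmn : m ≤ n) : gramDisc m n ≠ 0 := by
  intro h
  let u : Matrix (Fin m) (Fin n) ℂ := Matrix.of fun i j => if (i : ℕ) = j then (i : ℂ) + 1 else 0
  have hu : toMat (ofMat u) * (toMat (ofMat u)).transpose =
      Matrix.diagonal fun i : Fin m => ((i : ℂ) + 1) ^ 2 := by
    ext i k
    rw [toMat_ofMat, Matrix.mul_apply, Finset.sum_eq_single (Fin.castLE hmn i)]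
    · by_cases hik : i = k
      · simp [u, hik, pow_two]
      · have : (k : ℕ) ≠ i := fun h => hik (Fin.ext h.symm)
        simp [u, hik, this]
    · intro j _ hj
      have : (i : ℕ) ≠ j := fun h => hj (Fin.ext h.symm)
      simp [u, this]
    · simp
  refine (eval_gramDisc_ne_zero_iff (ofMat u)).2 ?_ (by rw [h, map_zero])
  rw [hu, Matrix.charpoly_diagonal, Matrix.det_diagonal]
  refine ⟨separable_prod_X_sub_C_iff.2 fun i j hij => ?_, ?_⟩
  · have h2 : (((i : ℕ) + 1) ^ 2 : ℕ) = ((j : ℕ) + 1) ^ 2 := by exact_mod_cast hij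
    have h3 := Nat.pow_left_injective two_ne_zero h2
    exact Fin.ext (by simpa using h3)
  · exact Finset.prod_ne_zero_iff.2 fun i _ => pow_ne_zero _ (Nat.cast_add_one_ne_zero _)

theorem eval_eval_sqDist {σ : Type*} [Fintype σ] (x y : σ → ℂ) (Q : (MvPolynomial σ ℂ)[X]) :
    MvPolynomial.eval (Sum.elim x (x + y)) ((Q.map inU).eval (sqDist σ)) =
      (Q.map (MvPolynomial.eval (x + y))).eval (∑ i, y i ^ 2) := by
  rw [← eval_map_apply, Polynomial.map_map]
  congr 1
  · simp [sqDist]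
  · congr 1
    exact RingHom.ext fun p => eval_inU _ _ _

end Gram

/-! ### ED polynomials as characteristic polynomials -/

section RankVarieties

variable {m n r : ℕ}

/-- The ED polynomial of `X_r` is the characteristic polynomial in `t²` of a matrix `B` over `ℂ[u]`
as soon as, at each critical pair `(x, x + y)`, `q(y)` is an eigenvalue of `B(x + y)` and, for
generic real `u`, the critical points with data `u` realize `m` distinct eigenvalues. -/
theorem isEDPoly_charpoly (hmn : m ≤ n)
    (B : Matrix (Fin m) (Fin m) (MvPolynomial (Fin m × Fin n) ℂ))
    (h₁ : ∀ x y : Matrix (Fin m) (Fin n) ℂ, x.rank ≤ r → (y = 0 ∨ (x.rank = r ∧ IsNormalTo x y)) →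
      (B.map (MvPolynomial.eval (ofMat (x + y)))).charpoly.eval (y * y.transpose).trace = 0)
    (h₂ : ∀ v : Fin m × Fin n → ℝ,
      MvPolynomial.eval (fun i => (v i : ℂ)) (gramDisc m n) ≠ 0 →
        ∃ l : Fin m → ℂ, Function.Injective l ∧ ∀ i, ∃ x y : Matrix (Fin m) (Fin n) ℂ,
          toMat (fun i => (v i : ℂ)) = x + y ∧ x.rank = r ∧ IsNormalTo x y ∧
            (y * y.transpose).trace = l i) :
    IsEDPoly (rankVariety m n r) (((-1) ^ m * B.charpoly).comp (Polynomial.X ^ 2)) := by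
  have hev : ∀ (x y : Matrix (Fin m) (Fin n) ℂ) (Q : (MvPolynomial (Fin m × Fin n) ℂ)[X]),
      MvPolynomial.eval (Sum.elim (ofMat x) (ofMat x + ofMat y))
        ((Q.map inU).eval (sqDist (Fin m × Fin n))) =
          (Q.map (MvPolynomial.eval (ofMat (x + y)))).eval (y * y.transpose).trace := by
    intro x y Q
    rw [eval_eval_sqDist, sum_ofMat_sq]
    rfl
  refine isEDPoly_of_forall_dvd ?_ fun Q hQ => ?_
  · rw [Polynomial.map_mul, eval_mul]
    refine Ideal.mul_mem_left _ _ (mem_criticalIdeal_rankVariety fun x y hx hy => ?_)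
    rw [← ofMat_toMat x, ← ofMat_toMat y, hev, ← Matrix.charpoly_map]
    exact h₁ _ _ hx (hy.imp (fun h => congrArg toMat h) id)
  · have hu : IsUnit ((-1 : (MvPolynomial (Fin m × Fin n) ℂ)[X]) ^ m) := ⟨(-1) ^ m, by simp⟩
    refine (hu.mul_left_dvd).2 (dvd_of_generic_roots (Matrix.charpoly_monic B)
      ((Matrix.charpoly_natDegree_eq_dim B).trans (Fintype.card_fin m)) (gramDisc_ne_zero hmn)
        fun v hv => ?_)
    obtain ⟨l, hl, h⟩ := h₂ v hv
    refine ⟨l, hl, fun i => ?_⟩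
    obtain ⟨x, y, hxy, hx, hy, hyl⟩ := h i
    have hv' : (fun i => (v i : ℂ)) = ofMat (x + y) := by rw [← hxy, ofMat_toMat]
    rw [hv', ← hyl, ← Matrix.charpoly_map]
    refine ⟨h₁ x y hx.le (Or.inr ⟨hx, hy⟩), ?_⟩
    rw [← hev]
    exact eval_eq_zero_of_mem_criticalIdeal hQ (x := ofMat x) (y := ofMat y) hx hy

/-- For generic real `v`, the `m` eigenvectors of `v vᵀ` split `v` into critical pairs. -/
theorem exists_critical_pairs (v : Fin m × Fin n → ℝ)
    (hv : MvPolynomial.eval (fun i => (v i : ℂ)) (gramDisc m n) ≠ 0) :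
    ∃ l : Fin m → ℂ, Function.Injective l ∧ ∀ i, ∃ z w : Matrix (Fin m) (Fin n) ℂ,
      toMat (fun i => (v i : ℂ)) = z + w ∧ z.rank = 1 ∧ w.rank = m - 1 ∧ IsNormalTo z w ∧
        IsNormalTo w z ∧ (z * z.transpose).trace = l i ∧ (w * w.transpose).trace =
          (toMat (fun i => (v i : ℂ)) * (toMat (fun i => (v i : ℂ))).transpose).trace - l i := by
  obtain ⟨hs, hd⟩ := (eval_gramDisc_ne_zero_iff _).1 hv
  obtain ⟨l, α, hl, hα, hαl⟩ := exists_eigenvectors (Matrix.of fun i j => v (i, j)) hs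
  refine ⟨l, hl, fun i => exists_critical_pair (hα i) (hαl i) (fun h0 => hd ?_) hd⟩
  rw [← Matrix.exists_mulVec_eq_zero_iff]
  refine ⟨α i, fun h => ?_, ?_⟩
  · have := hα i
    rw [h] at this
    simp at this
  · have := hαl i
    rw [h0, zero_smul] at this
    exact this

theorem charpoly_eval_eq_zero_of_det {A : Matrix (Fin m) (Fin m) ℂ} {t : ℂ}
    (h : (A - Matrix.scalar (Fin m) t).det = 0) : A.charpoly.eval t = 0 := by
  rw [Matrix.eval_charpoly, ← neg_sub, Matrix.det_neg, h, mul_zero]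

/-- The ED polynomial of `X_{m-1}` is the characteristic polynomial of `U Uᵀ`, up to sign. -/
theorem isEDPoly_rankVariety_pred (hm : 1 ≤ m) (hmn : m ≤ n) :
    IsEDPoly (rankVariety m n (m - 1))
      (((-1) ^ m * (gram m n).charpoly).comp (Polynomial.X ^ 2)) := by
  refine isEDPoly_charpoly hmn _ (fun x y hx hy => ?_) fun v hv => ?_
  · rw [gram_map, toMat_ofMat]
    refine charpoly_eval_eq_zero_of_det ?_
    -- `y = αβᵀ`, since its columns lie in the left kernel of `x`, which is a line unless `y = 0`.
    obtain ⟨α, β, hα, hαx, rfl, hβ⟩ : ∃ (α : Fin m → ℂ) (β : Fin n → ℂ), α ≠ 0 ∧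
        x.transpose.mulVec α = 0 ∧ y = Matrix.vecMulVec α β ∧ x.mulVec β = 0 := by
      rcases hy with rfl | ⟨hr, hy⟩
      · obtain ⟨α, hα, h⟩ := exists_mulVec_eq_zero_of_rank_lt (A := x.transpose) (by
          rw [Matrix.rank_transpose, Fintype.card_fin]; omega)
        exact ⟨α, 0, hα, h, Matrix.ext fun _ _ => (mul_zero _).symm, by simp⟩
      · obtain ⟨N, N', h1, h2, h3⟩ := exists_kernel_matrix x.transpose (d := 1) (by
          rw [Matrix.rank_transpose, hr, Fintype.card_fin]; omega)
        have hy' : y = Matrix.vecMulVec (fun i => N i 0) (fun j => (N' * y) 0 j) := by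
          ext i j
          have := congrFun (congrFun (h3 y hy.1) i) j
          rw [Matrix.mul_apply, Fin.sum_univ_one] at this
          exact this.symm
        have hα : (fun i => N i 0) ≠ 0 := by
          intro h
          have h0 : ∀ i, N i 0 = 0 := fun i => congrFun h i
          have := congrFun (congrFun h1 0) 0
          simp [Matrix.mul_apply, h0] at this
        refine ⟨_, _, hα, ?_, hy', ?_⟩
        · ext j
          exact congrFun (congrFun h2 j) 0
        · refine mulVec_eq_zero_of_isNormalTo hα ?_
          rw [← hy']
          exact hy.2
    rw [add_comm x, trace_vecMulVec_mul_transpose]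
    exact det_sub_eq_zero hα hαx hβ
  · obtain ⟨l, hl, h⟩ := exists_critical_pairs v hv
    refine ⟨l, hl, fun i => ?_⟩
    obtain ⟨z, w, h1, -, h3, -, h5, h6, -⟩ := h i
    exact ⟨w, z, by rw [h1, add_comm], h3, h5, h6⟩

/-- The ED polynomial of `X_1` is the characteristic polynomial of `tr(U Uᵀ) - U Uᵀ`, up to sign. -/
theorem isEDPoly_rankVariety_one (hm : 1 ≤ m) (hmn : m ≤ n) :
    IsEDPoly (rankVariety m n 1) (((-1) ^ m * (Matrix.scalar (Fin m) (gram m n).trace -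
      gram m n).charpoly).comp (Polynomial.X ^ 2)) := by
  refine isEDPoly_charpoly hmn _ (fun x y hx hy => ?_) fun v hv => ?_
  · have hB : (Matrix.scalar (Fin m) (gram m n).trace - gram m n).map
        (MvPolynomial.eval (ofMat (x + y))) =
        Matrix.scalar (Fin m) ((x + y) * (x + y).transpose).trace - (x + y) * (x + y).transpose := by
      have h := gram_map (m := m) (n := n) (ofMat (x + y))
      rw [toMat_ofMat] at h
      rw [Matrix.map_sub _ (map_sub _), ← h]
      congr 1
      ext i j
      have htr : MvPolynomial.eval (ofMat (x + y)) (gram m n).trace =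
          ((gram m n).map (MvPolynomial.eval (ofMat (x + y)))).trace := by
        simp [Matrix.trace]
      by_cases hij : i = j
      · simp [htr, hij]
      · simp [hij]
    have hxy : IsNormalTo x y := by
      rcases hy with rfl | ⟨-, hy⟩
      · simp [IsNormalTo]
      · exact hy
    obtain ⟨A, C, hAC⟩ := exists_mul_of_rank_le hx
    obtain ⟨α, β, hα, rfl, hy0⟩ : ∃ (α : Fin m → ℂ) (β : Fin n → ℂ), α ≠ 0 ∧
        x = Matrix.vecMulVec α β ∧ y.transpose.mulVec α = 0 := by
      by_cases hx0 : x = 0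
      · refine ⟨Pi.single ⟨0, hm⟩ 1, 0, by simp, hx0.trans (Matrix.ext fun _ _ => (mul_zero _).symm), ?_⟩
        rcases hy with rfl | ⟨hr, -⟩
        · rw [Matrix.transpose_zero, Matrix.zero_mulVec]
        · rw [hx0, Matrix.rank_zero] at hr
          exact absurd hr zero_ne_one
      · have hx' : x = Matrix.vecMulVec (fun i => A i 0) (fun j => C 0 j) := by
          ext i j
          rw [hAC, Matrix.mul_apply, Fin.sum_univ_one]
          rfl
        have hβ : (fun j => C 0 j) ≠ 0 := fun h => hx0 (hx'.trans (by
          rw [h]; exact Matrix.ext fun _ _ => mul_zero _))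
        refine ⟨_, _, fun h => hx0 (by rw [hx', h, Matrix.zero_vecMulVec]), hx', ?_⟩
        refine mulVec_eq_zero_of_isNormalTo hβ ?_
        rw [Matrix.transpose_vecMulVec, ← hx']
        exact hxy.symm.1
    rw [hB, Matrix.eval_charpoly, trace_add_mul_transpose hxy, map_add, trace_vecMulVec_mul_transpose]
    have h := det_sub_eq_zero hα hy0 (mulVec_eq_zero_of_isNormalTo hα hxy.symm.2)
    rw [← h]
    congr 1
    abel
  · obtain ⟨l, hl, h⟩ := exists_critical_pairs v hv
    refine ⟨fun i => (toMat (fun i => (v i : ℂ)) * (toMat (fun i => (v i : ℂ))).transpose).trace - l i,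
      fun i j hij => hl (sub_right_injective hij), fun i => ?_⟩
    obtain ⟨z, w, h1, h2, -, h4, -, -, h7⟩ := h i
    exact ⟨z, w, h1, h2, h4, h7⟩

end RankVarieties
end EDPoly

end

theorem theorem8p1 (m n : ℕ) (hm : 1 ≤ m) (hmn : m ≤ n) :
    EDPoly.IsEDPoly (EDPoly.dualVariety (EDPoly.rankVariety m n 1))
        (EDPoly.dataMatrix m n * (EDPoly.dataMatrix m n).transpose
          - (Polynomial.X ^ 2 : (MvPolynomial (Fin m × Fin n) ℂ)[X]) •
            (1 : Matrix (Fin m) (Fin m) (MvPolynomial (Fin m × Fin n) ℂ)[X])).det ∧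
      EDPoly.IsEDPoly (EDPoly.rankVariety m n 1)
        ((-1) ^ m *
          ((Polynomial.X ^ 2 : (MvPolynomial (Fin m × Fin n) ℂ)[X]) •
              (1 : Matrix (Fin m) (Fin m) (MvPolynomial (Fin m × Fin n) ℂ)[X])
            + EDPoly.dataMatrix m n * (EDPoly.dataMatrix m n).transpose
            - (EDPoly.dataMatrix m n * (EDPoly.dataMatrix m n).transpose).trace •
              (1 : Matrix (Fin m) (Fin m) (MvPolynomial (Fin m × Fin n) ℂ)[X])).det) := by
  have hgram : EDPoly.dataMatrix m n * (EDPoly.dataMatrix m n).transpose =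
      (EDPoly.gram m n).map C := by
    rw [EDPoly.gram, Matrix.map_mul]
    rfl
  have hchar : ∀ B : Matrix (Fin m) (Fin m) (MvPolynomial (Fin m × Fin n) ℂ),
      B.charpoly.comp (X ^ 2) = ((X ^ 2 : (MvPolynomial (Fin m × Fin n) ℂ)[X]) •
        (1 : Matrix (Fin m) (Fin m) (MvPolynomial (Fin m × Fin n) ℂ)[X]) - B.map C).det := by
    intro B
    rw [← Polynomial.coe_compRingHom_apply, Matrix.charpoly, RingHom.map_det]
    congr 1
    ext1 i j
    by_cases hij : i = j
    · subst hij
      simp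
    · simp [hij]
  have hneg : ∀ (P : (MvPolynomial (Fin m × Fin n) ℂ)[X]),
      ((-1) ^ m * P).comp (X ^ 2) = (-1) ^ m * P.comp (X ^ 2) := by
    intro P
    simp
  constructor
  · have h := EDPoly.isEDPoly_rankVariety_pred hm hmn
    rw [hneg, hchar] at h
    rw [EDPoly.dualVariety_rankVariety_one hm hmn, hgram, ← neg_sub, Matrix.det_neg, Fintype.card_fin]
    exact h
  · have h := EDPoly.isEDPoly_rankVariety_one hm hmn
    rw [hneg, hchar] at h
    convert h using 3
    rw [hgram]
    have htr : ((EDPoly.gram m n).map C).trace = C (EDPoly.gram m n).trace := by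
      simp [Matrix.trace]
    ext1 i j
    by_cases hij : i = j
    · simp [hij, htr]
      ring
    · simp [hij]
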